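/- Let $p$ be a prime, $S$ a finite $p$-group and $\mathcal F$ a saturated fusion system on $S$. Write $\mathcal F(Q,P)$ for the set of $\mathcal F$-morphisms $Q\to P$, and $[Q]_{\mathcal F}$ for the set of subgroups of $S$ that are $\mathcal F$-conjugate (isomorphic in $\mathcal F$) to $Q$. Let $A(S)$ be the Burnside ring of $S$, i.e. the Grothendieck ring of finite $S$-sets, and $A(\mathcal F)\subseteq A(S)$ the subring of $\mathcal F$-stable elements, i.e. those $X$ whose restriction along every morphism $\varphi\colon P\to S$ in $\mathcal F$ equals, in $A(P)$, the restriction of $X$ along the inclusion $P\le S$. Let $A(\mathcal F)_{(p)}\subseteq A(S)_{(p)}$ be the $p$-localizations, and for $Q\le S$ let $\Phi_Q\colon A(S)_{(p)}\to\mathbb Z_{(p)}$ be the homomorphism that counts $Q$-fixed points. There is a $\mathbb Z_{(p)}$-linear map $\pi\colon A(S)_{(p)}\to A(\mathcal F)_{(p)}$ such that for every $X$, $\pi(X)$ is the unique element of $A(S)_{(p)}$ with \[\Phi_Q(\pi(X))=\frac1{|[Q]_{\mathcal F}|}\sum_{Q'\in[Q]_{\mathcal F}}\Phi_{Q'}(X)\qquad\text{for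 all }Q\le S.\] Put $\beta_P:=\pi([S/P])$ for $P\le S$. Then: 1. $\beta_P$ depends only on the $\mathcal F$-conjugacy class of $P$, and the elements $\beta_P$, with $P$ running over the subgroups of $S$ up to $\mathcal F$-conjugacy, form a $\mathbb Z_{(p)}$-basis of $A(\mathcal F)_{(p)}$. 2. For all $P,Q\le S$, \[\Phi_Q(\beta_P)=\frac{|\mathcal F(Q,P)|\cdot|S|}{|P|\cdot|\mathcal F(Q,S)|}.\] 3. For each $P\le S$, the element $\beta_P$ is the following $\mathbb Z_{(p)}$-linear combination of transitive $S$-sets, where $[R]_S$ runs over the $S$-conjugacy classes of subgroups of $S$ and $\mu$ is the Möbius function of the poset of subgroups of $S$: \[\beta_P=\sum_{[R]_S}\frac1{\Phi_R([S/R])}\Bigl(\sum_{R\le Q\le S}\Phi_Q(\beta_P)\,\mu(R,Q)\Bigr)[S/R] =\sum_{[R]_S}\frac{|R|\cdot|S|}{|N_S R|\cdot|P|}\Bigl(\sum_{R\le Q\le S}\frac{|\mathcal F(Q,P)|}{|\mathcal F(Q,S)|}\,\mu(R,Q)\Bigr)[S/R].\] In particular, the coefficients lie in $\mathbb Z_{(p)}$,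 and the coefficient of $[S/R]$ is $0$ unless $R$ is $\mathcal F$-conjugate to a subgroup of $P$. -/

import Mathlib

open scoped TensorProduct

universe u

/-! ### The Grothendieck ring of a commutative semiring -/

/-- The additive Grothendieck group of a commutative semiring. -/
def GrothendieckRing (M : Type*) [CommSemiring M] : Type _ :=
  Algebra.GrothendieckAddGroup M

namespace GrothendieckRing

open Algebra

variable {M : Type*} [CommSemiring M]

noncomputable instance : AddCommGroup (GrothendieckRing M) :=
  inferInstanceAs (AddCommGroup (GrothendieckAddGroup M))

/-- The canonical additive map from `M`. -/
noncomputable def of : M →+ GrothendieckRing M := GrothendieckAddGroup.of (M := M)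

/-- The universal property: additive extension to abelian groups. -/
noncomputable def liftAdd {G : Type*} [AddCommGroup G] (f : M →+ G) : GrothendieckRing M →+ G :=
  GrothendieckAddGroup.lift f

theorem liftAdd_of {G : Type*} [AddCommGroup G] (f : M →+ G) (m : M) :
    liftAdd f (of m) = f m :=
  DFunLike.congr_fun (GrothendieckAddGroup.lift.symm_apply_apply f) m

theorem exists_sub (x : GrothendieckRing M) : ∃ a b : M, x = of a - of b := by
  change GrothendieckAddGroup M at x
  change ∃ a b : M, x = GrothendieckAddGroup.of a - GrothendieckAddGroup.of b
  induction x using AddLocalization.ind with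
  | _ y =>
    obtain ⟨a, b⟩ := y
    refine ⟨a, b, ?_⟩
    rw [eq_sub_iff_add_eq]
    simp only [GrothendieckAddGroup.of, AddSubmonoid.LocalizationMap.toAddMonoidHom_apply,
      ← AddLocalization.mk_zero_eq_addMonoidOf_mk, AddLocalization.mk_add]
    rw [AddLocalization.mk_eq_mk_iff, AddLocalization.r_iff_exists]
    exact ⟨0, by simp [add_comm]⟩

theorem addHom_ext {G : Type*} [AddCommGroup G] {f g : GrothendieckRing M →+ G}
    (h : ∀ m, f (of m) = g (of m)) : f = g := by
  ext x
  obtain ⟨a, b, rfl⟩ := exists_sub x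
  rw [map_sub, map_sub, h, h]

/-- Multiplication, extended biadditively from the semiring `M`. -/
noncomputable def mulHom : GrothendieckRing M →+ GrothendieckRing M →+ GrothendieckRing M :=
  liftAdd
    { toFun := fun m => liftAdd (of.comp (AddMonoidHom.mulLeft m))
      map_zero' := addHom_ext fun x => by simp [liftAdd_of]
      map_add' := fun a b => addHom_ext fun x => by simp [liftAdd_of, add_mul] }

theorem mulHom_of (a b : M) : mulHom (of a) (of b) = of (a * b) := by
  rw [mulHom, liftAdd_of]
  exact liftAdd_of _ b

noncomputable instance : Mul (GrothendieckRing M) := ⟨fun x y => mulHom x y⟩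

noncomputable instance : One (GrothendieckRing M) := ⟨of 1⟩

theorem mul_def (x y : GrothendieckRing M) : x * y = mulHom x y := rfl

theorem one_def : (1 : GrothendieckRing M) = of 1 := rfl

protected theorem mul_comm' (x y : GrothendieckRing M) : x * y = y * x := by
  obtain ⟨a, b, rfl⟩ := exists_sub x
  obtain ⟨c, d, rfl⟩ := exists_sub y
  simp only [mul_def, map_sub, AddMonoidHom.sub_apply, mulHom_of, mul_comm c, mul_comm d]
  abel

protected theorem mul_assoc' (x y z : GrothendieckRing M) : x * y * z = x * (y * z) := by
  obtain ⟨a, b, rfl⟩ := exists_sub x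
  obtain ⟨c, d, rfl⟩ := exists_sub y
  obtain ⟨e, f, rfl⟩ := exists_sub z
  simp only [mul_def, map_sub, AddMonoidHom.sub_apply, mulHom_of, mul_assoc]

protected theorem one_mul' (x : GrothendieckRing M) : 1 * x = x := by
  obtain ⟨a, b, rfl⟩ := exists_sub x
  simp only [mul_def, one_def, map_sub, mulHom_of, one_mul]

noncomputable instance : CommRing (GrothendieckRing M) :=
  { (inferInstance : AddCommGroup (GrothendieckRing M)) with
    mul := (· * ·)
    one := 1
    mul_comm := GrothendieckRing.mul_comm'
    mul_assoc := GrothendieckRing.mul_assoc'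
    one_mul := GrothendieckRing.one_mul'
    mul_one := fun x => by rw [GrothendieckRing.mul_comm', GrothendieckRing.one_mul']
    zero_mul := fun x => by simp [mul_def]
    mul_zero := fun x => by simp [mul_def]
    left_distrib := fun x y z => by simp [mul_def]
    right_distrib := fun x y z => by simp [mul_def] }

/-- A semiring homomorphism to a commutative ring extends to the Grothendieck ring. -/
noncomputable def lift {R : Type*} [CommRing R] (f : M →+* R) : GrothendieckRing M →+* R :=
  { liftAdd (f : M →+ R) with
    map_one' := by
      change liftAdd (f : M →+ R) (of 1) = 1
      rw [liftAdd_of]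
      exact map_one f
    map_mul' := fun x y => by
      change liftAdd (f : M →+ R) (x * y) = liftAdd (f : M →+ R) x * liftAdd (f : M →+ R) y
      obtain ⟨a, b, rfl⟩ := exists_sub x
      obtain ⟨c, d, rfl⟩ := exists_sub y
      simp only [mul_def, map_sub, AddMonoidHom.sub_apply, mulHom_of, liftAdd_of,
        AddMonoidHom.coe_coe, map_mul]
      ring }

/-- The canonical map from `M`, as a semiring homomorphism. -/
noncomputable def ofHom : M →+* GrothendieckRing M :=
  { (of : M →+ GrothendieckRing M) with
    map_one' := rfl
    map_mul' := fun a b => (mulHom_of a b).symm }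

end GrothendieckRing

/-! ### The Burnside ring of a group -/

/-- A finite left `G`-set. -/
structure FinGSet (G : Type u) [Group G] where
  carrier : Type u
  [finite : Finite carrier]
  [action : MulAction G carrier]

namespace FinGSet

attribute [instance] FinGSet.finite FinGSet.action

variable {G : Type u} [Group G]

/-- Isomorphism of `G`-sets. -/
def Iso (X Y : FinGSet G) : Prop :=
  ∃ e : X.carrier ≃ Y.carrier, ∀ (g : G) (x : X.carrier), e (g • x) = g • e x

instance isoSetoid (G : Type u) [Group G] : Setoid (FinGSet G) where
  r := Iso
  iseqv :=
    { refl := fun _ => ⟨Equiv.refl _, fun _ _ => rfl⟩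
      symm := fun ⟨e, he⟩ => ⟨e.symm, fun g y => by
        rw [Equiv.symm_apply_eq, he, Equiv.apply_symm_apply]⟩
      trans := fun ⟨e, he⟩ ⟨f, hf⟩ => ⟨e.trans f, fun g x => by simp [he, hf]⟩ }

/-- Disjoint union. -/
def sum (X Y : FinGSet G) : FinGSet G := ⟨X.carrier ⊕ Y.carrier⟩

/-- Cartesian product with the diagonal action. -/
def prod (X Y : FinGSet G) : FinGSet G := ⟨X.carrier × Y.carrier⟩

/-- The empty `G`-set. -/
def empty (G : Type u) [Group G] : FinGSet G :=
  { carrier := PEmpty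
    action :=
      { smul := fun _ x => x
        one_smul := fun _ => rfl
        mul_smul := fun _ _ _ => rfl } }

/-- The one-point `G`-set. -/
def point (G : Type u) [Group G] : FinGSet G :=
  { carrier := PUnit
    action :=
      { smul := fun _ x => x
        one_smul := fun _ => rfl
        mul_smul := fun _ _ _ => rfl } }

/-- Restriction of the action along a group homomorphism: `h` acts as `φ h`. -/
def res {H : Type u} [Group H] (φ : H →* G) (X : FinGSet G) : FinGSet H :=
  { carrier := X.carrier
    action := MulAction.compHom X.carrier φ }

/-- The transitive `G`-set `G/P`. -/
def coset [Finite G] (P : Subgroup G) : FinGSet G := ⟨G ⧸ P⟩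

/-- The number of `P`-fixed points. -/
noncomputable def fixedCard (P : Subgroup G) (X : FinGSet G) : ℕ :=
  Nat.card (MulAction.fixedPoints P X.carrier)

end FinGSet

/-- Isomorphism classes of finite `G`-sets. -/
def FinGSetClass (G : Type u) [Group G] : Type (u + 1) := Quotient (FinGSet.isoSetoid G)

namespace FinGSetClass

variable {G : Type u} [Group G]

/-- The isomorphism class of a finite `G`-set. -/
def mk (X : FinGSet G) : FinGSetClass G := Quotient.mk _ X

instance : Add (FinGSetClass G) :=
  ⟨Quotient.map₂ FinGSet.sum fun _ _ ⟨e, he⟩ _ _ ⟨f, hf⟩ =>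
    ⟨Equiv.sumCongr e f, fun g x => by
      cases x with
      | inl x => exact congrArg Sum.inl (he g x)
      | inr x => exact congrArg Sum.inr (hf g x)⟩⟩

instance : Zero (FinGSetClass G) := ⟨mk (FinGSet.empty G)⟩

instance : Mul (FinGSetClass G) :=
  ⟨Quotient.map₂ FinGSet.prod fun _ _ ⟨e, he⟩ _ _ ⟨f, hf⟩ =>
    ⟨Equiv.prodCongr e f, fun g x => Prod.ext (he g x.1) (hf g x.2)⟩⟩

instance : One (FinGSetClass G) := ⟨mk (FinGSet.point G)⟩

instance : CommSemiring (FinGSetClass G) where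
  nsmul := nsmulRec
  add_assoc := by
    rintro ⟨X⟩ ⟨Y⟩ ⟨Z⟩
    refine Quotient.sound ⟨Equiv.sumAssoc _ _ _, fun g x => ?_⟩
    rcases x with (x | x) | x <;> rfl
  zero_add := by
    rintro ⟨X⟩
    refine Quotient.sound ⟨Equiv.emptySum PEmpty X.carrier, fun g x => ?_⟩
    rcases x with x | x
    · exact x.elim
    · rfl
  add_zero := by
    rintro ⟨X⟩
    refine Quotient.sound ⟨Equiv.sumEmpty X.carrier PEmpty, fun g x => ?_⟩
    rcases x with x | x
    · rfl
    · exact x.elim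
  add_comm := by
    rintro ⟨X⟩ ⟨Y⟩
    refine Quotient.sound ⟨Equiv.sumComm _ _, fun g x => ?_⟩
    rcases x with x | x <;> rfl
  mul_assoc := by
    rintro ⟨X⟩ ⟨Y⟩ ⟨Z⟩
    exact Quotient.sound ⟨Equiv.prodAssoc _ _ _, fun g x => rfl⟩
  mul_comm := by
    rintro ⟨X⟩ ⟨Y⟩
    exact Quotient.sound ⟨Equiv.prodComm _ _, fun g x => rfl⟩
  one_mul := by
    rintro ⟨X⟩
    exact Quotient.sound ⟨Equiv.punitProd X.carrier, fun g x => rfl⟩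
  mul_one := by
    rintro ⟨X⟩
    exact Quotient.sound ⟨Equiv.prodPUnit X.carrier, fun g x => rfl⟩
  zero_mul := by
    rintro ⟨X⟩
    exact Quotient.sound ⟨Equiv.pemptyProd X.carrier, fun g x => x.1.elim⟩
  mul_zero := by
    rintro ⟨X⟩
    exact Quotient.sound ⟨Equiv.prodPEmpty X.carrier, fun g x => x.2.elim⟩
  left_distrib := by
    rintro ⟨X⟩ ⟨Y⟩ ⟨Z⟩
    refine Quotient.sound ⟨Equiv.prodSumDistrib _ _ _, fun g x => ?_⟩
    rcases x with ⟨x, y | z⟩ <;> rfl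
  right_distrib := by
    rintro ⟨X⟩ ⟨Y⟩ ⟨Z⟩
    refine Quotient.sound ⟨Equiv.sumProdDistrib _ _ _, fun g x => ?_⟩
    rcases x with ⟨x | y, z⟩ <;> rfl

/-- Restriction along a group homomorphism, on isomorphism classes. -/
def res {H : Type u} [Group H] (φ : H →* G) : FinGSetClass G →+* FinGSetClass H where
  toFun := Quotient.map (FinGSet.res φ) fun _ _ ⟨e, he⟩ => ⟨e, fun h x => he (φ h) x⟩
  map_zero' := Quotient.sound ⟨Equiv.refl _, fun _ x => x.elim⟩
  map_one' := Quotient.sound ⟨Equiv.refl _, fun _ _ => rfl⟩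
  map_add' := by
    rintro ⟨X⟩ ⟨Y⟩
    refine Quotient.sound ⟨Equiv.refl _, fun h x => ?_⟩
    rcases x with x | x <;> rfl
  map_mul' := by
    rintro ⟨X⟩ ⟨Y⟩
    exact Quotient.sound ⟨Equiv.refl _, fun h x => rfl⟩

/-- The number of `P`-fixed points, on isomorphism classes. -/
noncomputable def fixedCard (P : Subgroup G) : FinGSetClass G →+* ℤ where
  toFun := Quotient.lift (fun X => (FinGSet.fixedCard P X : ℤ)) fun X Y ⟨e, he⟩ => by
    refine congrArg Nat.cast (Nat.card_congr (e.subtypeEquiv fun x => ?_))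
    refine forall_congr' fun h => ?_
    change (h : G) • x = x ↔ (h : G) • e x = e x
    rw [← he, e.apply_eq_iff_eq]
  map_zero' := by
    change ((Nat.card (MulAction.fixedPoints P (FinGSet.empty G).carrier) : ℕ) : ℤ) = 0
    have : IsEmpty (FinGSet.empty G).carrier := inferInstanceAs (IsEmpty PEmpty)
    simp
  map_one' := by
    change ((Nat.card (MulAction.fixedPoints P (FinGSet.point G).carrier) : ℕ) : ℤ) = 1
    have : Unique (MulAction.fixedPoints P (FinGSet.point G).carrier) :=
      { default := ⟨PUnit.unit, fun _ => rfl⟩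
        uniq := fun _ => rfl }
    simp
  map_add' := by
    rintro ⟨X⟩ ⟨Y⟩
    change ((Nat.card (MulAction.fixedPoints P (X.carrier ⊕ Y.carrier)) : ℕ) : ℤ) =
      (Nat.card (MulAction.fixedPoints P X.carrier) : ℤ) +
        (Nat.card (MulAction.fixedPoints P Y.carrier) : ℤ)
    rw [← Nat.cast_add, ← Nat.card_sum]
    refine congrArg Nat.cast (Nat.card_congr ((Equiv.subtypeSum).trans
      (Equiv.sumCongr (Equiv.subtypeEquivRight fun x => ?_)
        (Equiv.subtypeEquivRight fun x => ?_))))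
    · exact forall_congr' fun h => Sum.inl_injective.eq_iff
    · exact forall_congr' fun h => Sum.inr_injective.eq_iff
  map_mul' := by
    rintro ⟨X⟩ ⟨Y⟩
    change ((Nat.card (MulAction.fixedPoints P (X.carrier × Y.carrier)) : ℕ) : ℤ) =
      (Nat.card (MulAction.fixedPoints P X.carrier) : ℤ) *
        (Nat.card (MulAction.fixedPoints P Y.carrier) : ℤ)
    rw [← Nat.cast_mul, ← Nat.card_prod]
    refine congrArg Nat.cast (Nat.card_congr ((Equiv.subtypeEquivRight fun x => ?_).trans
      (Equiv.subtypeProdEquivProd (p := fun x => x ∈ MulAction.fixedPoints P X.carrier)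
        (q := fun y => y ∈ MulAction.fixedPoints P Y.carrier))))
    exact ⟨fun hx => ⟨fun h => congrArg Prod.fst (hx h), fun h => congrArg Prod.snd (hx h)⟩,
      fun hx h => Prod.ext (hx.1 h) (hx.2 h)⟩

end FinGSetClass

/-- The Burnside ring `A(G)`: the Grothendieck ring of the semiring of isomorphism classes of
finite `G`-sets. -/
abbrev BurnsideRing (G : Type u) [Group G] : Type (u + 1) := GrothendieckRing (FinGSetClass G)

namespace BurnsideRing

variable {G : Type u} [Group G]

/-- The class `[G/P]` in `A(G)`. -/
noncomputable def coset [Finite G] (P : Subgroup G) : BurnsideRing G :=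
  GrothendieckRing.of (FinGSetClass.mk (FinGSet.coset P))

/-- The restriction homomorphism `r_φ : A(G) → A(H)` along `φ : H → G`. -/
noncomputable def res {H : Type u} [Group H] (φ : H →* G) : BurnsideRing G →+* BurnsideRing H :=
  GrothendieckRing.lift (GrothendieckRing.ofHom.comp (FinGSetClass.res φ))

/-- The fixed point homomorphism `Φ_P : A(G) → ℤ`. -/
noncomputable def mark (P : Subgroup G) : BurnsideRing G →+* ℤ :=
  GrothendieckRing.lift (FinGSetClass.fixedCard P)

end BurnsideRing

/-! ### Localization at a prime -/

/-- The ring `ℤ_(p)` of rational numbers whose denominator is prime to `p`. -/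
def ZLocal (p : ℕ) [hp : Fact p.Prime] : Subring ℚ where
  carrier := {q | ¬ p ∣ q.den}
  zero_mem' := by simpa using hp.out.one_lt.ne'
  one_mem' := by simpa using hp.out.one_lt.ne'
  add_mem' := fun {a b} ha hb h =>
    ((hp.out.dvd_mul).1 (h.trans (Rat.add_den_dvd a b))).elim ha hb
  mul_mem' := fun {a b} ha hb h =>
    ((hp.out.dvd_mul).1 (h.trans (Rat.mul_den_dvd a b))).elim ha hb
  neg_mem' := fun {a} ha => by simpa using ha

/-- The `p`-localized Burnside ring `A(G)_(p) = ℤ_(p) ⊗ A(G)`. -/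
abbrev LocalBurnsideRing (p : ℕ) [Fact p.Prime] (G : Type u) [Group G] : Type (u + 1) :=
  ZLocal p ⊗[ℤ] BurnsideRing G

namespace LocalBurnsideRing

variable (p : ℕ) [Fact p.Prime] {G : Type u} [Group G]

/-- The class `[G/P]` in `A(G)_(p)`. -/
noncomputable def coset [Finite G] (P : Subgroup G) : LocalBurnsideRing p G :=
  (1 : ZLocal p) ⊗ₜ[ℤ] BurnsideRing.coset P

/-- The fixed point homomorphism `Φ_P : A(G)_(p) → ℤ_(p)`. -/
noncomputable def mark (P : Subgroup G) : LocalBurnsideRing p G →ₐ[ZLocal p] ZLocal p :=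
  Algebra.TensorProduct.lift (AlgHom.id (ZLocal p) (ZLocal p))
    ((Int.castRingHom (ZLocal p)).comp (BurnsideRing.mark P)).toIntAlgHom
    fun _ _ => Commute.all _ _

end LocalBurnsideRing

/-! ### Fusion systems -/

/-- Conjugation `x ↦ s x s⁻¹` as a homomorphism `P → Q`, for `s P s⁻¹ ≤ Q`. -/
def conjHom {S : Type u} [Group S] (P Q : Subgroup S) (s : S)
    (h : ∀ x ∈ P, s * x * s⁻¹ ∈ Q) : P →* Q where
  toFun x := ⟨s * x * s⁻¹, h x x.2⟩
  map_one' := by ext; simp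
  map_mul' x y := by ext; simp

/-- A fusion system on `S`: `Hom P Q` is the set of morphisms from `P` to `Q`. -/
structure FusionSystem (S : Type u) [Group S] where
  Hom : ∀ P Q : Subgroup S, Set (P →* Q)
  injective : ∀ {P Q : Subgroup S} {φ : P →* Q}, φ ∈ Hom P Q → Function.Injective φ
  comp_mem : ∀ {P Q R : Subgroup S} {φ : P →* Q} {ψ : Q →* R},
    φ ∈ Hom P Q → ψ ∈ Hom Q R → ψ.comp φ ∈ Hom P R
  conj_mem : ∀ (P Q : Subgroup S) (s : S) (h : ∀ x ∈ P, s * x * s⁻¹ ∈ Q), conjHom P Q s h ∈ Hom P Q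
  /-- The corestriction of a morphism `φ` to its image `φ P` is a morphism. -/
  corestrict_mem : ∀ {P Q : Subgroup S} {φ : P →* Q}, φ ∈ Hom P Q →
    (Q.subtype.comp φ).rangeRestrict ∈ Hom P (Q.subtype.comp φ).range
  /-- The inverse `φ P → P` of the corestriction is a morphism. -/
  inverse_mem : ∀ {P Q : Subgroup S} {φ : P →* Q}, φ ∈ Hom P Q →
    ∀ ψ : (Q.subtype.comp φ).range →* P,
      (∀ x : P, ψ ((Q.subtype.comp φ).rangeRestrict x) = x) → ψ ∈ Hom (Q.subtype.comp φ).range P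

namespace FusionSystem

variable {S : Type u} [Group S] (F : FusionSystem S)

theorem id_mem (P : Subgroup S) : MonoidHom.id P ∈ F.Hom P P := by
  have h := F.conj_mem P P 1 (fun x hx => by simpa using hx)
  convert h using 1
  ext x
  simp [conjHom]

theorem symm_mem {P Q : Subgroup S} (e : P ≃* Q) (he : e.toMonoidHom ∈ F.Hom P Q) :
    e.symm.toMonoidHom ∈ F.Hom Q P := by
  have hr : ∀ x : S, x ∈ (Q.subtype.comp e.toMonoidHom).range → x ∈ Q := by
    rintro _ ⟨y, rfl⟩
    exact (e y).2
  have hQ : ∀ x ∈ Q, (1 : S) * x * 1⁻¹ ∈ (Q.subtype.comp e.toMonoidHom).range := by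
    intro x hx
    exact ⟨e.symm ⟨x, hx⟩, by simp⟩
  have h1 := F.conj_mem Q (Q.subtype.comp e.toMonoidHom).range 1 hQ
  have h2 := F.inverse_mem he (e.symm.toMonoidHom.comp (Subgroup.inclusion hr)) (by
    intro x
    exact e.symm_apply_apply x)
  convert F.comp_mem h1 h2 using 1
  ext x
  change (e.symm x : S) = e.symm ⟨1 * x * 1⁻¹, _⟩
  congr 2
  ext
  simp

/-- `F`-conjugacy of subgroups: `P ∼_F Q`. -/
def Conj (P Q : Subgroup S) : Prop := ∃ φ ∈ F.Hom P Q, Function.Bijective φ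

/-- `F`-conjugacy as an equivalence relation. -/
def conjSetoid : Setoid (Subgroup S) where
  r := F.Conj
  iseqv :=
    { refl := fun P => ⟨_, F.id_mem P, Function.bijective_id⟩
      symm := fun ⟨φ, hφ, hb⟩ =>
        ⟨(MulEquiv.ofBijective φ hb).symm.toMonoidHom, F.symm_mem (MulEquiv.ofBijective φ hb) hφ,
          (MulEquiv.ofBijective φ hb).symm.bijective⟩
      trans := fun ⟨_, hφ, hb⟩ ⟨_, hψ, hb'⟩ => ⟨_, F.comp_mem hφ hψ, hb'.comp hb⟩ }

/-- The set of `F`-conjugacy classes of subgroups. -/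
abbrev ConjClass : Type u := Quotient F.conjSetoid

/-- `Q` is `F`-subconjugate to `P`: `Q` is `F`-conjugate to a subgroup of `P`. -/
def SubConj (Q P : Subgroup S) : Prop := ∃ Q' ≤ P, F.Conj Q Q'

/-- `P` is fully `F`-normalized. -/
def FullyNormalized (P : Subgroup S) : Prop :=
  ∀ Q, F.Conj P Q → Nat.card (Subgroup.normalizer (Q : Set S)) ≤
    Nat.card (Subgroup.normalizer (P : Set S))

/-- `P` is fully `F`-centralized. -/
def FullyCentralized (P : Subgroup S) : Prop :=
  ∀ Q, F.Conj P Q → Nat.card (Subgroup.centralizer (Q : Set S)) ≤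
    Nat.card (Subgroup.centralizer (P : Set S))

/-- The automorphism group `Aut_F(P)`. -/
def aut (P : Subgroup S) : Subgroup (MulAut P) where
  carrier := {α | MulEquiv.toMonoidHom α ∈ F.Hom P P}
  one_mem' := F.id_mem P
  mul_mem' := fun ha hb => F.comp_mem hb ha
  inv_mem' := fun {a} ha => F.symm_mem a ha

/-- The subgroup `N_φ = {x ∈ N_S(P) | ∃ y ∈ S, φ ∘ c_x = c_y ∘ φ}`. -/
def extender {P : Subgroup S} (φ : P →* S) : Subgroup S where
  carrier := {x | x ∈ Subgroup.normalizer (P : Set S) ∧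
    ∃ y : S, ∀ g h : P, (h : S) = x * g * x⁻¹ → φ h = y * φ g * y⁻¹}
  one_mem' := ⟨one_mem _, 1, fun g h hh => by
    have : h = g := by ext; simpa using hh
    simp [this]⟩
  mul_mem' := by
    rintro a b ⟨ha, y, hy⟩ ⟨hb, z, hz⟩
    refine ⟨mul_mem ha hb, y * z, fun g h hh => ?_⟩
    have hbg : b * g * b⁻¹ ∈ P := (Subgroup.mem_normalizer_iff.1 hb g).1 g.2
    rw [hy ⟨_, hbg⟩ h (by rw [hh]; group), hz g ⟨_, hbg⟩ rfl]
    group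
  inv_mem' := by
    rintro a ⟨ha, y, hy⟩
    refine ⟨inv_mem ha, y⁻¹, fun g h hh => ?_⟩
    rw [hy h g (by rw [hh]; group)]
    group

/-- Saturation at the prime `p`. -/
structure IsSaturated (p : ℕ) : Prop where
  /-- Fully normalized subgroups are fully centralized, and `Aut_S(P)`, the image of `N_S(P)`, is a
  Sylow `p`-subgroup of `Aut_F(P)`. -/
  sylow : ∀ P : Subgroup S, F.FullyNormalized P → F.FullyCentralized P ∧
    ∃ T : Sylow p (F.aut P), (T : Subgroup (F.aut P)).map (F.aut P).subtype =
      P.normalizerMonoidHom.range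
  /-- A morphism `φ : P → S` with fully centralized image extends to `N_φ`. -/
  extend : ∀ (P : Subgroup S) (φ : P →* (⊤ : Subgroup S)), φ ∈ F.Hom P ⊤ →
    F.FullyCentralized ((⊤ : Subgroup S).subtype.comp φ).range →
    ∃ ψ ∈ F.Hom (extender ((⊤ : Subgroup S).subtype.comp φ)) ⊤,
      ∀ (x : P) (x' : extender ((⊤ : Subgroup S).subtype.comp φ)), (x : S) = x' → ψ x' = φ x

/-- The Burnside ring `A(F)`: the subring of `F`-stable elements of `A(S)`, those `X` with
`r_φ X = r_incl X` in `A(P)` for all morphisms `φ : P → S` of `F`. -/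
def burnsideRing : Subring (BurnsideRing S) where
  carrier := {X | ∀ (P : Subgroup S) (φ : P →* (⊤ : Subgroup S)), φ ∈ F.Hom P ⊤ →
    BurnsideRing.res ((⊤ : Subgroup S).subtype.comp φ) X = BurnsideRing.res P.subtype X}
  zero_mem' := fun _ _ _ => by simp
  one_mem' := fun _ _ _ => by simp
  add_mem' := fun ha hb P φ hφ => by simp [ha P φ hφ, hb P φ hφ]
  mul_mem' := fun ha hb P φ hφ => by simp [ha P φ hφ, hb P φ hφ]
  neg_mem' := fun ha P φ hφ => by simp [ha P φ hφ]

/-- The `p`-localization `A(F)_(p)`, as the image of `ℤ_(p) ⊗ A(F)` in `A(S)_(p)`. -/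
noncomputable def localBurnsideRing (p : ℕ) [Fact p.Prime] :
    Subalgebra (ZLocal p) (LocalBurnsideRing p S) :=
  (Algebra.TensorProduct.map (AlgHom.id (ZLocal p) (ZLocal p))
    F.burnsideRing.subtype.toIntAlgHom).range

/-- `π : A(S)_(p) → A(F)_(p)` is the stabilization map: `π X` is the unique element of `A(S)_(p)`
whose mark at `Q` is the average of the marks of `X` over the `F`-conjugacy class of `Q`. -/
def IsStabilization (p : ℕ) [Fact p.Prime]
    (π : LocalBurnsideRing p S →ₗ[ZLocal p] F.localBurnsideRing p) : Prop :=
  ∀ X Y : LocalBurnsideRing p S, (π X : LocalBurnsideRing p S) = Y ↔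
    ∀ Q : Subgroup S, (LocalBurnsideRing.mark p Q Y : ℚ) =
      1 / (Nat.card {Q' : Subgroup S // F.Conj Q Q'} : ℚ) *
        ∑ᶠ Q' : {Q' : Subgroup S // F.Conj Q Q'}, (LocalBurnsideRing.mark p Q'.1 X : ℚ)

end FusionSystem

/-! ### Subgroups of `S` -/

/-- `S`-conjugacy of subgroups as an equivalence relation. -/
def subgroupConjSetoid (S : Type u) [Group S] : Setoid (Subgroup S) where
  r P Q := ∃ s : S, P.map (MulAut.conj s).toMonoidHom = Q
  iseqv :=
    { refl := fun P => ⟨1, by ext; simp⟩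
      symm := by
        rintro P _ ⟨s, rfl⟩
        refine ⟨s⁻¹, ?_⟩
        rw [Subgroup.map_map]
        ext x
        simp [mul_assoc]
      trans := by
        rintro P _ _ ⟨s, rfl⟩ ⟨t, rfl⟩
        refine ⟨t * s, ?_⟩
        rw [Subgroup.map_map]
        congr 1
        ext x
        simp }

open Classical in
/-- The Möbius function `μ(R, Q)` of the poset of subgroups of a finite group. -/
noncomputable def subgroupMoebius {S : Type u} [Group S] [Finite S] (R Q : Subgroup S) : ℤ :=
  letI := Fintype.ofFinite (Subgroup S)
  letI : LocallyFiniteOrder (Subgroup S) := Fintype.toLocallyFiniteOrder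
  IncidenceAlgebra.mu ℤ R Q

/-! ### Decomposition of finite `G`-sets into orbits -/

namespace FinGSetClass

variable {G : Type u} [Group G] [Finite G]

/-! Transitive sets span the Burnside ring, and Möbius inversion over the subgroup poset recovers
each coefficient from the marks (`moebiusTransform_eq_of_marks`, `LocalBurnsideRing.coeff_eq`).
Hence marks determine an element, and everything rests on one existence statement: some element has
as marks the class averages of the marks of `X` (`exists_mark_eq_average`).

It is built by corrections from large subgroups down. Suppose the marks of `X` are constant on
`F`-classes of subgroups of order greater than `n`. For each `R` of order `n`, up to `S`-conjugacy,
add `[S/R]` with coefficient (average at `R` minus `Φ_R(X)`) divided by `Φ_R(S/R) = |N_S R : R|`.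
This stabilizes order `n`, leaves larger subgroups alone, and changes no average, because deviations
from the average cancel within each `F`-class.

The coefficient must be `p`-local (`exists_average_sub_mark_eq`), for two reasons. First, if `P` is
fully normalized in the class of `R`, some isomorphism `R → P` extends to `N_S(R)`. The two
resulting restrictions of `X` to `N_S(R)` have a difference whose marks vanish strictly above `R`,
so `Φ_P(X) - Φ_R(X)` is divisible by `|N_S R : R|` (`exists_mark_sub_mark_eq`). Second, the `p`-part
of the class size of `P` divides `|S : N_S P|`, so dividing by that size is harmless
(`not_dvd_card_conj`). This follows from a bound on `|F(P,S)|` (`not_dvd_card_mor`), proved by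
climbing from `P` to `N_S(P)`: under `S × N_S(P)`, the orbits of size not divisible by `p|S :
C_S(P)|` consist of the morphisms that extend to `N_S(P)`.

Once `π` exists, the marks of `β_P` come from double counting (`average_mark_coset`), the basis from
`π` being a projection together with a triangular table of marks, and the coefficients from Möbius
inversion. -/

theorem mk_eq_coset_add (X : FinGSet G) (x : X.carrier) :
    ∃ Y : FinGSet G, Nat.card Y.carrier < Nat.card X.carrier ∧
      mk X = mk (FinGSet.coset (MulAction.stabilizer G x)) + mk Y ∧
        ((∀ y, ∃ g : G, g • x = y) → IsEmpty Y.carrier) := by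
  let T : SubMulAction G X.carrier :=
    { carrier := (MulAction.orbit G x)ᶜ
      smul_mem' := fun g y hy h => hy <| by
        simpa using MulAction.mem_orbit_of_mem_orbit g⁻¹ h }
  refine ⟨⟨T⟩, ?_, ?_, ?_⟩
  · exact Finite.card_subtype_lt (x := x) fun h => h (MulAction.mem_orbit_self _)
  · symm
    let f : (G ⧸ MulAction.stabilizer G x) ⊕ T → X.carrier :=
      Sum.elim (MulAction.ofQuotientStabilizer G x) Subtype.val
    have hf : Function.Bijective f := by
      constructor
      · refine (MulAction.injective_ofQuotientStabilizer G x).sumElim Subtype.val_injective ?_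
        rintro a ⟨y, hy⟩ h
        exact hy (by rw [← show _ = y from h]; exact MulAction.ofQuotientStabilizer_mem_orbit G x a)
      · intro y
        by_cases hy : y ∈ MulAction.orbit G x
        · obtain ⟨g, rfl⟩ := hy
          exact ⟨Sum.inl g, rfl⟩
        · exact ⟨Sum.inr ⟨y, hy⟩, rfl⟩
    refine Quotient.sound ⟨Equiv.ofBijective f hf, ?_⟩
    rintro g (a | y)
    · exact MulAction.ofQuotientStabilizer_smul G x g a
    · rfl
  · intro h
    exact ⟨fun y => y.2 (h y)⟩

theorem mk_eq_zero {G : Type u} [Group G] (X : FinGSet G) [IsEmpty X.carrier] : mk X = 0 :=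
  Quotient.sound ⟨Equiv.equivOfIsEmpty _ PEmpty, fun _ x => isEmptyElim x⟩

theorem mk_eq_coset (X : FinGSet G) (x : X.carrier) (h : ∀ y, ∃ g : G, g • x = y) :
    mk X = mk (FinGSet.coset (MulAction.stabilizer G x)) := by
  obtain ⟨Y, -, hY, he⟩ := mk_eq_coset_add X x
  have := he h
  rw [hY, mk_eq_zero Y, add_zero]

theorem mk_coset_map_conj (P : Subgroup G) (s : G) :
    mk (FinGSet.coset (P.map (MulAut.conj s).toMonoidHom)) = mk (FinGSet.coset P) := by
  rw [mk_eq_coset (FinGSet.coset P) (s : G ⧸ P)]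
  · congr 2
    have := MulAction.stabilizer_smul_eq_stabilizer_map_conj s ((1 : G) : G ⧸ P)
    rw [MulAction.stabilizer_quotient] at this
    rw [← this]
    congr 1
    exact congrArg (QuotientGroup.mk (s := P)) (mul_one s)
  · intro y
    obtain ⟨y, rfl⟩ := QuotientGroup.mk_surjective y
    exact ⟨y * s⁻¹, congrArg (QuotientGroup.mk (s := P)) (inv_mul_cancel_right y s)⟩

theorem mk_mem_closure_coset (X : FinGSet G) :
    mk X ∈ AddSubmonoid.closure (Set.range fun P : Subgroup G => mk (FinGSet.coset P)) := by
  induction h : Nat.card X.carrier using Nat.strong_induction_on generalizing X with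
  | _ n ih =>
    subst h
    rcases isEmpty_or_nonempty X.carrier with hX | ⟨⟨x⟩⟩
    · rw [mk_eq_zero]
      exact zero_mem _
    · obtain ⟨Y, hlt, hY, -⟩ := mk_eq_coset_add X x
      rw [hY]
      exact add_mem (AddSubmonoid.subset_closure ⟨_, rfl⟩) (ih _ hlt Y rfl)

end FinGSetClass

/-! ### Möbius inversion of fixed point counts -/

section Moebius

variable {G : Type u} [Group G] [Finite G]

/-- The functional `f ↦ ∑_{R ≤ Q} f(Q) μ(R, Q)`. -/
noncomputable def moebiusTransform (R : Subgroup G) : (Subgroup G → ℚ) →ₗ[ℚ] ℚ where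
  toFun f := ∑ᶠ Q : {Q : Subgroup G // R ≤ Q}, f Q.1 * (subgroupMoebius R Q.1 : ℚ)
  map_add' f g := by
    simp only [Pi.add_apply, add_mul]
    exact finsum_add_distrib (Set.toFinite _) (Set.toFinite _)
  map_smul' c f := by
    simp only [Pi.smul_apply, smul_eq_mul, mul_assoc, RingHom.id_apply]
    exact (mul_finsum _ _ ).symm

theorem moebiusTransform_apply (R : Subgroup G) (f : Subgroup G → ℚ) :
    moebiusTransform R f =
      ∑ᶠ Q : {Q : Subgroup G // R ≤ Q}, f Q.1 * (subgroupMoebius R Q.1 : ℚ) := rfl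

/-- Turns integrality of a Möbius transform into divisibility of the single value `f R`. -/
theorem moebiusTransform_eq_self_of_forall_lt (R : Subgroup G) (f : Subgroup G → ℚ)
    (h : ∀ Q, R < Q → f Q = 0) : moebiusTransform R f = f R := by
  rw [moebiusTransform_apply, finsum_eq_single _ ⟨R, le_rfl⟩]
  · simp [subgroupMoebius]
  · rintro ⟨Q, hQ⟩ hne
    rw [h Q (lt_of_le_of_ne hQ fun h => hne (Subtype.ext h.symm)), zero_mul]

/-- The `Q`-fixed points are sorted by their stabilizers `K ≥ Q`, so fixed point counts are upward
sums of stabilizer counts, and Möbius inversion from the top undoes this. -/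
theorem moebiusTransform_fixedCard (R : Subgroup G) (X : FinGSet G) :
    moebiusTransform R (fun Q => (FinGSet.fixedCard Q X : ℚ)) =
      Nat.card {x : X.carrier // MulAction.stabilizer G x = R} := by
  classical
  let := Fintype.ofFinite (Subgroup G)
  let : LocallyFiniteOrder (Subgroup G) := Fintype.toLocallyFiniteOrder
  let := Fintype.ofFinite X.carrier
  have key := IncidenceAlgebra.moebius_inversion_top
    (fun Q : Subgroup G => (Nat.card {x : X.carrier // MulAction.stabilizer G x = Q} : ℤ))
    (fun Q : Subgroup G => (FinGSet.fixedCard Q X : ℤ)) (fun Q => by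
      have h1 : FinGSet.fixedCard Q X =
          (Finset.univ.filter fun x : X.carrier => Q ≤ MulAction.stabilizer G x).card := by
        rw [← Fintype.card_subtype, ← Nat.card_eq_fintype_card]
        refine Nat.card_congr (Equiv.subtypeEquivRight fun x => ?_)
        exact ⟨fun h g hg => h ⟨g, hg⟩, fun h g => h g.2⟩
      rw [h1, Finset.card_eq_sum_card_fiberwise (f := fun x => MulAction.stabilizer G x)
        (t := Finset.Ici Q)]
      · push_cast
        refine Finset.sum_congr rfl fun K hK => ?_
        rw [Nat.card_eq_fintype_card, Fintype.card_subtype]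
        congr 2
        ext x
        simp only [Finset.mem_filter, Finset.mem_univ, true_and, and_iff_right_iff_imp]
        rintro rfl
        simpa using hK
      · intro x hx
        simpa using hx) R
  have key' := congrArg (Int.cast : ℤ → ℚ) key
  push_cast at key'
  rw [key', moebiusTransform_apply, finsum_eq_sum_of_fintype]
  rw [Finset.sum_subtype (p := fun Q => R ≤ Q) (Finset.Ici R) (by simp)]
  refine Finset.sum_congr rfl fun Q _ => ?_
  rw [mul_comm]
  congr 2

theorem conj_of_stabilizer_coset {R K : Subgroup G} (x : (FinGSet.coset K).carrier)
    (hx : MulAction.stabilizer G x = R) : (subgroupConjSetoid G).r R K := by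
  obtain ⟨s, rfl⟩ := QuotientGroup.mk_surjective (s := K) x
  have := MulAction.stabilizer_smul_eq_stabilizer_map_conj s ((1 : G) : G ⧸ K)
  rw [MulAction.stabilizer_quotient] at this
  refine (subgroupConjSetoid G).symm ⟨s, ?_⟩
  rw [← this, ← hx]
  congr 1
  exact congrArg (QuotientGroup.mk (s := K)) (mul_one s)

theorem mem_fixedPoints_coset_iff {G : Type u} [Group G] (Q P : Subgroup G) (s : G) :
    ((s : G ⧸ P) ∈ MulAction.fixedPoints Q (G ⧸ P)) ↔
      Q.map (MulAut.conj s⁻¹).toMonoidHom ≤ P := by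
  rw [Subgroup.map_le_iff_le_comap]
  refine ⟨fun h x hx => ?_, fun h x => ?_⟩
  · have := QuotientGroup.eq.1 (h ⟨x⁻¹, inv_mem hx⟩)
    simpa [mul_assoc] using this
  · have : s⁻¹ * (x : G)⁻¹ * s⁻¹⁻¹ ∈ P := h (inv_mem x.2)
    refine QuotientGroup.eq.2 ?_
    simpa [mul_assoc, Subgroup.smul_def] using this

/-- The preimage in `G` of the fixed cosets is a union of cosets of `P`, each of size `|P|`. -/
theorem fixedCard_coset_mul_card (Q P : Subgroup G) :
    FinGSet.fixedCard Q (FinGSet.coset P) * Nat.card P =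
      Nat.card {s : G // Q.map (MulAut.conj s⁻¹).toMonoidHom ≤ P} := by
  have h : ∀ s : G, ((s : G ⧸ P) ∈ MulAction.fixedPoints Q (G ⧸ P)) ↔
      Q.map (MulAut.conj s⁻¹).toMonoidHom ≤ P := mem_fixedPoints_coset_iff Q P
  have e := QuotientGroup.preimageMkEquivSubgroupProdSet P (MulAction.fixedPoints Q (G ⧸ P))
  rw [mul_comm]
  refine (Nat.card_prod _ _).symm.trans (Nat.card_congr (e.symm.trans ?_))
  exact Equiv.subtypeEquivRight h

theorem card_map_conj {G : Type u} [Group G] (Q : Subgroup G) (s : G) :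
    Nat.card (Q.map (MulAut.conj s).toMonoidHom) = Nat.card Q :=
  Subgroup.card_map_of_injective (MulAut.conj s).injective

theorem fixedCard_coset_ne_zero {Q P : Subgroup G}
    (h : FinGSet.fixedCard Q (FinGSet.coset P) ≠ 0) :
    ∃ s : G, Q.map (MulAut.conj s).toMonoidHom ≤ P := by
  have hne : Nat.card {s : G // Q.map (MulAut.conj s⁻¹).toMonoidHom ≤ P} ≠ 0 := by
    rw [← fixedCard_coset_mul_card]
    exact mul_ne_zero h Nat.card_pos.ne'
  obtain ⟨⟨s, hs⟩⟩ := (Nat.card_ne_zero.1 hne).1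
  exact ⟨_, hs⟩

theorem map_conj_le_iff_mem_normalizer (Q : Subgroup G) (s : G) :
    Q.map (MulAut.conj s).toMonoidHom ≤ Q ↔ s ∈ Subgroup.normalizer (Q : Set G) := by
  rw [Subgroup.mem_normalizer_iff_map_conj_eq]
  exact ⟨fun h => Subgroup.eq_of_le_of_card_ge h (card_map_conj Q s).ge, fun h => h.le⟩

theorem fixedCard_coset_self (R : Subgroup G) :
    FinGSet.fixedCard R (FinGSet.coset R) * Nat.card R =
      Nat.card (Subgroup.normalizer (R : Set G)) := by
  rw [fixedCard_coset_mul_card]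
  refine Nat.card_congr (Equiv.subtypeEquivRight fun s => ?_)
  rw [map_conj_le_iff_mem_normalizer, inv_mem_iff]

theorem fixedCard_coset_self_cast (R : Subgroup G) :
    (FinGSet.fixedCard R (FinGSet.coset R) : ℚ) =
      Nat.card (Subgroup.normalizer (R : Set G)) / Nat.card R := by
  rw [eq_div_iff (by exact_mod_cast Nat.card_pos.ne'), ← Nat.cast_mul, fixedCard_coset_self]

theorem fixedCard_coset_self_ne_zero (R : Subgroup G) :
    FinGSet.fixedCard R (FinGSet.coset R) ≠ 0 := fun h => by
  have := fixedCard_coset_self R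
  rw [h, zero_mul] at this
  exact Nat.card_pos.ne this

end Moebius

/-! ### The Burnside ring is spanned by transitive sets, and marks are injective -/

theorem GrothendieckRing.lift_of {M R : Type*} [CommSemiring M] [CommRing R] (f : M →+* R) (m : M) :
    lift f (of m) = f m :=
  liftAdd_of (f : M →+ R) m

namespace BurnsideRing

variable {G : Type u} [Group G]

theorem mark_of_mk (Q : Subgroup G) (X : FinGSet G) :
    mark Q (GrothendieckRing.of (FinGSetClass.mk X)) = FinGSet.fixedCard Q X :=
  GrothendieckRing.lift_of _ _

theorem res_of_mk {H : Type u} [Group H] (φ : H →* G) (X : FinGSet G) :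
    res φ (GrothendieckRing.of (FinGSetClass.mk X)) =
      GrothendieckRing.of (FinGSetClass.mk (X.res φ)) :=
  GrothendieckRing.lift_of _ _

theorem mark_res {H : Type u} [Group H] (φ : H →* G) (Q : Subgroup H) (y : BurnsideRing G) :
    mark Q (res φ y) = mark (Q.map φ) y := by
  have : ((mark Q).comp (res φ) : BurnsideRing G →+ ℤ) = (mark (Q.map φ) : BurnsideRing G →+ ℤ) := by
    refine GrothendieckRing.addHom_ext ?_
    rintro ⟨X⟩
    change mark Q (res φ (GrothendieckRing.of (FinGSetClass.mk X))) =
      mark (Q.map φ) (GrothendieckRing.of (FinGSetClass.mk X))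
    rw [res_of_mk, mark_of_mk, mark_of_mk]
    refine congrArg Nat.cast (Nat.card_congr (Equiv.subtypeEquivRight fun x => ?_))
    constructor
    · rintro h ⟨_, g, hg, rfl⟩
      exact h ⟨g, hg⟩
    · intro h g
      exact h ⟨φ g, Subgroup.mem_map_of_mem φ g.2⟩
  exact DFunLike.congr_fun this y

theorem mark_map_conj (Q : Subgroup G) (s : G) (y : BurnsideRing G) :
    mark (Q.map (MulAut.conj s).toMonoidHom) y = mark Q y := by
  have : (mark (Q.map (MulAut.conj s).toMonoidHom) : BurnsideRing G →+ ℤ) =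
      (mark Q : BurnsideRing G →+ ℤ) := by
    refine GrothendieckRing.addHom_ext ?_
    rintro ⟨X⟩
    change mark _ (GrothendieckRing.of (FinGSetClass.mk X)) =
      mark _ (GrothendieckRing.of (FinGSetClass.mk X))
    rw [mark_of_mk, mark_of_mk]
    refine congrArg Nat.cast (Nat.card_congr
      (((MulAction.toPerm s).subtypeEquiv fun x => ?_).symm))
    constructor
    · rintro h ⟨_, g, hg, rfl⟩
      have hg' : g • x = x := h ⟨g, hg⟩
      change (s * g * s⁻¹) • s • x = s • x
      rw [smul_smul, inv_mul_cancel_right, mul_smul, hg']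
    · rintro h ⟨g, hg⟩
      have hg' : (s * g * s⁻¹) • s • x = s • x := h ⟨_, g, hg, rfl⟩
      rw [smul_smul, inv_mul_cancel_right, mul_smul] at hg'
      exact smul_left_cancel s hg'
  exact DFunLike.congr_fun this y

variable [Finite G]

theorem mark_coset (Q P : Subgroup G) : mark Q (coset P) = FinGSet.fixedCard Q (FinGSet.coset P) :=
  mark_of_mk _ _

theorem coset_eq_of_conj {P Q : Subgroup G} (h : (subgroupConjSetoid G).r P Q) :
    coset P = coset Q := by
  obtain ⟨s, rfl⟩ := h
  rw [coset, coset, FinGSetClass.mk_coset_map_conj]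

theorem coset_out (P : Subgroup G) :
    coset (Quotient.mk (subgroupConjSetoid G) P).out = coset P :=
  coset_eq_of_conj (Quotient.mk_out (s := subgroupConjSetoid G) P)

theorem exists_eq_sum_coset (y : BurnsideRing G) :
    ∃ n : Quotient (subgroupConjSetoid G) → ℤ, y = ∑ᶠ r, n r • coset r.out := by
  have := Fintype.ofFinite (Quotient (subgroupConjSetoid G))
  suffices y ∈ Submodule.span ℤ
      (Set.range fun r : Quotient (subgroupConjSetoid G) => coset r.out) by
    obtain ⟨c, hc⟩ := (Submodule.mem_span_range_iff_exists_fun ℤ).1 this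
    exact ⟨c, by rw [finsum_eq_sum_of_fintype, hc]⟩
  have hm : ∀ m : FinGSetClass G, GrothendieckRing.of m ∈ Submodule.span ℤ
      (Set.range fun r : Quotient (subgroupConjSetoid G) => coset r.out) := by
    rintro ⟨X⟩
    refine AddSubmonoid.closure_induction
      (motive := fun m _ => GrothendieckRing.of m ∈ Submodule.span ℤ
        (Set.range fun r : Quotient (subgroupConjSetoid G) => coset r.out)) ?_ ?_ ?_
      (FinGSetClass.mk_mem_closure_coset X)
    · rintro _ ⟨P, rfl⟩
      exact Submodule.subset_span ⟨Quotient.mk _ P, coset_out P⟩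
    · simp
    · intro a b _ _ ha hb
      rw [map_add]
      exact add_mem ha hb
  obtain ⟨a, b, rfl⟩ := GrothendieckRing.exists_sub y
  exact sub_mem (hm a) (hm b)

end BurnsideRing

open Classical in
-- Stabilizers in `G/K` are conjugates of `K`, so none equals `R` unless `R` and `K` are conjugate.
-- In `G/R`, a stabilizer containing `R` has the order of `R` and so equals it: points with
-- stabilizer `R` are the `R`-fixed points.
theorem moebiusTransform_coset {G : Type u} [Group G] [Finite G] (R K : Subgroup G) :
    moebiusTransform R (fun Q => (BurnsideRing.mark Q (BurnsideRing.coset K) : ℚ)) =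
      if (subgroupConjSetoid G).r R K then
        (BurnsideRing.mark R (BurnsideRing.coset R) : ℚ) else 0 := by
  split_ifs with h
  · rw [← BurnsideRing.coset_eq_of_conj h]
    simp only [BurnsideRing.mark_coset, Int.cast_natCast]
    rw [moebiusTransform_fixedCard]
    refine congrArg Nat.cast (Nat.card_congr (Equiv.subtypeEquivRight fun x => ?_))
    constructor
    · intro hx g
      exact hx.ge g.2
    · intro hx
      have hle : R ≤ MulAction.stabilizer G x := fun g hg => hx ⟨g, hg⟩
      obtain ⟨s, hs⟩ := conj_of_stabilizer_coset x rfl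
      refine (Subgroup.eq_of_le_of_card_ge hle ?_).symm
      exact (card_map_conj _ s).ge.trans (congrArg (fun K : Subgroup G => Nat.card K) hs).le
  · simp only [BurnsideRing.mark_coset, Int.cast_natCast]
    rw [moebiusTransform_fixedCard, Nat.cast_eq_zero]
    have : IsEmpty {x : (FinGSet.coset K).carrier // MulAction.stabilizer G x = R} :=
      ⟨fun x => h (conj_of_stabilizer_coset x.1 x.2)⟩
    exact Nat.card_of_isEmpty

/-- The Möbius transform reads off the coefficients with respect to transitive sets. -/
theorem moebiusTransform_eq_of_marks {G : Type u} [Group G] [Finite G]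
    (f : Subgroup G → ℚ) (c : Quotient (subgroupConjSetoid G) → ℚ)
    (h : ∀ Q, f Q = ∑ᶠ r, c r * (BurnsideRing.mark Q (BurnsideRing.coset r.out) : ℚ))
    (R : Subgroup G) :
    moebiusTransform R f =
      c (Quotient.mk _ R) * (BurnsideRing.mark R (BurnsideRing.coset R) : ℚ) := by
  classical
  have := Fintype.ofFinite (Quotient (subgroupConjSetoid G))
  have hf : f = ∑ r, c r • fun Q => (BurnsideRing.mark Q (BurnsideRing.coset r.out) : ℚ) := by
    ext Q
    rw [h, finsum_eq_sum_of_fintype]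
    simp
  rw [hf, map_sum, Finset.sum_eq_single (Quotient.mk _ R)]
  · rw [map_smul, moebiusTransform_coset, if_pos, smul_eq_mul]
    exact (subgroupConjSetoid G).symm (Quotient.mk_out (s := subgroupConjSetoid G) R)
  · intro r _ hr
    rw [map_smul, moebiusTransform_coset, if_neg, smul_zero]
    intro h
    refine hr ?_
    rw [← Quotient.out_eq r]
    exact Quotient.sound ((subgroupConjSetoid G).symm h)
  · simp

namespace BurnsideRing

variable {G : Type u} [Group G] [Finite G]

theorem mark_eq_sum {y : BurnsideRing G} {n : Quotient (subgroupConjSetoid G) → ℤ}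
    (h : y = ∑ᶠ r, n r • coset r.out) (Q : Subgroup G) :
    (mark Q y : ℚ) = ∑ᶠ r, (n r : ℚ) * (mark Q (coset r.out) : ℚ) := by
  have := Fintype.ofFinite (Quotient (subgroupConjSetoid G))
  rw [h, finsum_eq_sum_of_fintype, finsum_eq_sum_of_fintype, map_sum]
  simp

/-- The integer is the coefficient of `[G/R]` in `y`. Its integrality is the source of the
congruences between marks. -/
theorem exists_moebiusTransform_mark_eq (R : Subgroup G) (y : BurnsideRing G) :
    ∃ n : ℤ, moebiusTransform R (fun Q => (mark Q y : ℚ)) = n * (mark R (coset R) : ℚ) := by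
  obtain ⟨n, hn⟩ := exists_eq_sum_coset y
  exact ⟨_, moebiusTransform_eq_of_marks _ (fun r => n r) (mark_eq_sum hn) R⟩

theorem mark_self_ne_zero (R : Subgroup G) : (mark R (coset R) : ℚ) ≠ 0 := by
  rw [mark_coset]
  exact_mod_cast fixedCard_coset_self_ne_zero R

theorem eq_of_mark_eq {x y : BurnsideRing G} (h : ∀ Q, mark Q x = mark Q y) : x = y := by
  rw [← sub_eq_zero]
  obtain ⟨n, hn⟩ := exists_eq_sum_coset (x - y)
  have hz : ∀ r, n r = 0 := by
    intro r
    have := moebiusTransform_eq_of_marks _ (fun r => n r) (mark_eq_sum hn) r.out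
    simp only [map_sub, h, sub_self, Int.cast_zero] at this
    rw [show (fun _ : Subgroup G => (0 : ℚ)) = 0 from rfl, map_zero, Quotient.out_eq] at this
    exact_mod_cast (mul_eq_zero.1 this.symm).resolve_right (mark_self_ne_zero _)
  rw [hn]
  simp [hz]

end BurnsideRing

/-! ### The localized Burnside ring -/

theorem ZLocal.inv_natCast_mem (p : ℕ) [Fact p.Prime] {m : ℕ} (hm : ¬ p ∣ m) :
    ((m : ℚ)⁻¹) ∈ ZLocal p := by
  have h0 : m ≠ 0 := by rintro rfl; exact hm (dvd_zero p)
  change ¬ p ∣ ((m : ℚ)⁻¹).den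
  rwa [Rat.inv_natCast_den_of_pos (Nat.pos_of_ne_zero h0)]

namespace LocalBurnsideRing

variable (p : ℕ) [hp : Fact p.Prime] {G : Type u} [Group G]

theorem mark_tmul (Q : Subgroup G) (z : ZLocal p) (y : BurnsideRing G) :
    (mark p Q (z ⊗ₜ y) : ℚ) = z * BurnsideRing.mark Q y := by
  simp [mark]

theorem exists_smul_eq_tmul (X : LocalBurnsideRing p G) :
    ∃ m : ℕ, ¬ p ∣ m ∧ ∃ x : BurnsideRing G, (m : ZLocal p) • X = 1 ⊗ₜ x := by
  induction X using TensorProduct.induction_on with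
  | zero => exact ⟨1, by simpa using hp.out.one_lt.ne', 0, by simp⟩
  | tmul z y =>
    refine ⟨(z : ℚ).den, z.2, (z : ℚ).num • y, ?_⟩
    rw [TensorProduct.smul_tmul', ← TensorProduct.smul_tmul]
    congr 1
    ext
    simp [Rat.den_mul_eq_num]
  | add X Y hX hY =>
    obtain ⟨m, hm, x, hx⟩ := hX
    obtain ⟨n, hn, y, hy⟩ := hY
    refine ⟨m * n, fun h => (hp.out.dvd_mul.1 h).elim hm hn, (n : ℤ) • x + (m : ℤ) • y, ?_⟩
    have h1 : ((m * n : ℕ) : ZLocal p) • X = (n : ZLocal p) • ((m : ZLocal p) • X) := by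
      rw [smul_smul]; push_cast; ring_nf
    have h2 : ((m * n : ℕ) : ZLocal p) • Y = (m : ZLocal p) • ((n : ZLocal p) • Y) := by
      rw [smul_smul]; push_cast; ring_nf
    rw [smul_add, h1, h2, hx, hy, TensorProduct.tmul_add, TensorProduct.smul_tmul',
      TensorProduct.smul_tmul', ← TensorProduct.smul_tmul, ← TensorProduct.smul_tmul]
    simp

theorem mark_smul (Q : Subgroup G) (z : ZLocal p) (X : LocalBurnsideRing p G) :
    (mark p Q (z • X) : ℚ) = z * mark p Q X := by
  simp

/-- A common denominator prime to `p` reduces questions about localized elements to honest elements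
of the Burnside ring. -/
theorem exists_eq_inv_tmul (X : LocalBurnsideRing p G) :
    ∃ m : ℕ, ¬ p ∣ m ∧ ∃ (z : ZLocal p) (x : BurnsideRing G), (z : ℚ) = (m : ℚ)⁻¹ ∧ X = z ⊗ₜ x := by
  obtain ⟨m, hm, x, hx⟩ := exists_smul_eq_tmul p X
  refine ⟨m, hm, ⟨_, ZLocal.inv_natCast_mem p hm⟩, x, rfl, ?_⟩
  have h0 : (m : ℚ) ≠ 0 := by
    norm_cast; rintro rfl; exact hm (dvd_zero p)
  have := congrArg (fun Y => (⟨_, ZLocal.inv_natCast_mem p hm⟩ : ZLocal p) • Y) hx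
  simp only [smul_smul] at this
  rw [TensorProduct.smul_tmul', smul_eq_mul, mul_one] at this
  rw [← this]
  convert (one_smul (ZLocal p) X).symm using 2
  ext
  simp [h0]

theorem mark_map_conj (Q : Subgroup G) (s : G) (X : LocalBurnsideRing p G) :
    (mark p (Q.map (MulAut.conj s).toMonoidHom) X : ℚ) = mark p Q X := by
  obtain ⟨m, hm, z, x, hz, rfl⟩ := exists_eq_inv_tmul p X
  rw [mark_tmul, mark_tmul, BurnsideRing.mark_map_conj]

variable [Finite G]

theorem mark_coset (Q P : Subgroup G) :
    (mark p Q (coset p P) : ℚ) = BurnsideRing.mark Q (BurnsideRing.coset P) := by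
  rw [coset, mark_tmul]
  simp

theorem coset_out (P : Subgroup G) :
    coset p (Quotient.mk (subgroupConjSetoid G) P).out = coset p P := by
  rw [coset, BurnsideRing.coset_out, coset]

theorem exists_eq_sum_coset (X : LocalBurnsideRing p G) :
    ∃ c : Quotient (subgroupConjSetoid G) → ZLocal p, X = ∑ᶠ r, c r • coset p r.out := by
  have := Fintype.ofFinite (Quotient (subgroupConjSetoid G))
  obtain ⟨m, hm, z, x, hz, rfl⟩ := exists_eq_inv_tmul p X
  obtain ⟨n, rfl⟩ := BurnsideRing.exists_eq_sum_coset x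
  refine ⟨fun r => n r • z, ?_⟩
  simp only [finsum_eq_sum_of_fintype, TensorProduct.tmul_sum]
  refine Finset.sum_congr rfl fun r _ => ?_
  rw [coset, TensorProduct.smul_tmul', ← TensorProduct.smul_tmul, smul_eq_mul, mul_one]

theorem mark_eq_sum {X : LocalBurnsideRing p G} {c : Quotient (subgroupConjSetoid G) → ZLocal p}
    (h : X = ∑ᶠ r, c r • coset p r.out) (Q : Subgroup G) :
    (mark p Q X : ℚ) =
      ∑ᶠ r, (c r : ℚ) * (BurnsideRing.mark Q (BurnsideRing.coset r.out) : ℚ) := by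
  have := Fintype.ofFinite (Quotient (subgroupConjSetoid G))
  rw [h, finsum_eq_sum_of_fintype, finsum_eq_sum_of_fintype, map_sum, AddSubmonoidClass.coe_finsetSum]
  refine Finset.sum_congr rfl fun r _ => ?_
  rw [mark_smul, mark_coset]

theorem coeff_eq {X : LocalBurnsideRing p G} {c : Quotient (subgroupConjSetoid G) → ZLocal p}
    (h : X = ∑ᶠ r, c r • coset p r.out) (R : Subgroup G) :
    (c (Quotient.mk _ R) : ℚ) = 1 / (BurnsideRing.mark R (BurnsideRing.coset R) : ℚ) *
      moebiusTransform R fun Q => (mark p Q X : ℚ) := by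
  rw [moebiusTransform_eq_of_marks _ (fun r => (c r : ℚ)) (mark_eq_sum p h) R]
  have := BurnsideRing.mark_self_ne_zero R
  field_simp

theorem eq_of_mark_eq {X Y : LocalBurnsideRing p G}
    (h : ∀ Q, (mark p Q X : ℚ) = mark p Q Y) : X = Y := by
  rw [← sub_eq_zero]
  obtain ⟨c, hc⟩ := exists_eq_sum_coset p (X - Y)
  have hz : ∀ r, c r = 0 := by
    intro r
    have := coeff_eq p hc r.out
    rw [Quotient.out_eq, show (fun Q => (mark p Q (X - Y) : ℚ)) = 0 by
      ext Q; simp [h], map_zero, mul_zero] at this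
    exact_mod_cast this
  rw [hc]
  simp [hz]

end LocalBurnsideRing

/-! ### Counting with finite group actions -/

theorem dvd_card_of_dvd_card_orbit {G T : Type*} [Group G] [MulAction G T] [Finite T] {m : ℕ}
    (h : ∀ t : T, m ∣ Nat.card (MulAction.orbit G t)) : m ∣ Nat.card T := by
  classical
  have := Fintype.ofFinite (MulAction.orbitRel.Quotient G T)
  rw [Nat.card_congr (MulAction.selfEquivSigmaOrbits G T), Nat.card_sigma]
  exact Finset.dvd_sum fun ω _ => h _

theorem dvd_card_setOf_dvd_card_orbit (G T : Type*) [Group G] [MulAction G T] [Finite T] (m : ℕ) :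
    m ∣ Nat.card {t : T // m ∣ Nat.card (MulAction.orbit G t)} := by
  let U : SubMulAction G T :=
    { carrier := {t | m ∣ Nat.card (MulAction.orbit G t)}
      smul_mem' := fun g t ht => by
        rwa [Set.mem_ofPred_eq, MulAction.orbit_smul] }
  refine dvd_card_of_dvd_card_orbit (G := G) (T := U) fun t => ?_
  rw [← Nat.card_image_of_injective Subtype.val_injective, SubMulAction.val_image_orbit]
  exact t.2

/-- The orbits of size divisible by `m` cover a multiple of `m` points, so discarding them preserves
divisibility of the total. -/
theorem dvd_card_setOf_not_dvd_card_orbit (G T : Type*) [Group G] [MulAction G T] [Finite T]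
    {m : ℕ} (h : m ∣ Nat.card T) :
    m ∣ Nat.card {t : T // ¬ m ∣ Nat.card (MulAction.orbit G t)} := by
  classical
  have e := Nat.card_congr (Equiv.sumCompl fun t : T => m ∣ Nat.card (MulAction.orbit G t))
  rw [Nat.card_sum] at e
  exact (Nat.dvd_add_right (dvd_card_setOf_dvd_card_orbit G T m)).1 (e ▸ h)

theorem card_range_normalizerMonoidHom_mul {S : Type u} [Group S] (P : Subgroup S) :
    Nat.card P.normalizerMonoidHom.range * Nat.card (Subgroup.centralizer (P : Set S)) =
      Nat.card (Subgroup.normalizer (P : Set S)) := by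
  rw [← Subgroup.index_ker, ← Subgroup.index_mul_card (P.normalizerMonoidHom.ker)]
  congr 1
  rw [Subgroup.normalizerMonoidHom_ker]
  exact (Nat.card_congr (Subgroup.subgroupOfEquivOfLe
    (Subgroup.centralizer_le_normalizer (P : Set S))).toEquiv).symm

namespace FusionSystem

variable {S : Type u} [Group S] (F : FusionSystem S)

/-! ### Morphisms into `S` -/

/-- The set `F(P, S)` of morphisms from `P` to `S`, as homomorphisms `P → S`. -/
def mor (P : Subgroup S) : Set (P →* S) :=
  {f | ∃ φ ∈ F.Hom P ⊤, (⊤ : Subgroup S).subtype.comp φ = f}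

theorem inclusion_mem {P Q : Subgroup S} (h : P ≤ Q) : Subgroup.inclusion h ∈ F.Hom P Q := by
  convert F.conj_mem P Q 1 (fun x hx => by simpa using h hx) using 1
  ext x
  simp [conjHom]

theorem subtype_comp_mem_mor {P Q : Subgroup S} {φ : P →* Q} (h : φ ∈ F.Hom P Q) :
    Q.subtype.comp φ ∈ F.mor P :=
  ⟨_, F.comp_mem h (F.inclusion_mem le_top), rfl⟩

theorem codRestrict_mem {P Q : Subgroup S} {f : P →* S} (hf : f ∈ F.mor P) (h : ∀ x, f x ∈ Q) :
    f.codRestrict Q h ∈ F.Hom P Q := by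
  obtain ⟨φ, hφ, rfl⟩ := hf
  exact F.comp_mem (F.corestrict_mem hφ)
    (F.inclusion_mem (P := ((⊤ : Subgroup S).subtype.comp φ).range) (by
      rintro _ ⟨x, rfl⟩; exact h x))

/-- Morphisms `P → Q` are morphisms `P → S` with image in `Q`. -/
def homEquiv (P Q : Subgroup S) : F.Hom P Q ≃ {f : F.mor P // ∀ x, f.1 x ∈ Q} where
  toFun φ := ⟨⟨_, F.subtype_comp_mem_mor φ.2⟩, fun x => (φ.1 x).2⟩
  invFun f := ⟨_, F.codRestrict_mem f.1.2 f.2⟩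
  left_inv _ := rfl
  right_inv _ := rfl

theorem card_mor (P : Subgroup S) : Nat.card (F.mor P) = Nat.card (F.Hom P ⊤) :=
  Nat.card_congr ((Equiv.subtypeUnivEquiv fun _ _ => Subgroup.mem_top _).symm.trans
    (F.homEquiv P ⊤).symm)

theorem mor_injective {P : Subgroup S} {f : P →* S} (hf : f ∈ F.mor P) :
    Function.Injective f := by
  obtain ⟨φ, hφ, rfl⟩ := hf
  exact Subtype.val_injective.comp (F.injective hφ)

theorem mor_comp {P Q : Subgroup S} {f : P →* Q} {g : Q →* S} (hf : f ∈ F.Hom P Q)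
    (hg : g ∈ F.mor Q) : g.comp f ∈ F.mor P := by
  obtain ⟨φ, hφ, rfl⟩ := hg
  exact ⟨_, F.comp_mem hf hφ, rfl⟩

theorem conj_comp_mem_mor {P : Subgroup S} {f : P →* S} (hf : f ∈ F.mor P) (s : S) :
    (MulAut.conj s).toMonoidHom.comp f ∈ F.mor P := by
  obtain ⟨φ, hφ, rfl⟩ := hf
  exact ⟨_, F.comp_mem hφ (F.conj_mem ⊤ ⊤ s fun _ _ => Subgroup.mem_top _), rfl⟩

theorem subtype_mem_mor (P : Subgroup S) : P.subtype ∈ F.mor P :=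
  F.subtype_comp_mem_mor (F.id_mem P)

theorem mor_restrict {P Q : Subgroup S} {f : Q →* S} (hf : f ∈ F.mor Q) (h : P ≤ Q) :
    f.comp (Subgroup.inclusion h) ∈ F.mor P :=
  F.mor_comp (F.inclusion_mem h) hf

theorem normalizerMonoidHom_mem_aut (P : Subgroup S) (n : Subgroup.normalizer (P : Set S)) :
    P.normalizerMonoidHom n ∈ F.aut P :=
  F.conj_mem P P n fun x hx => (Subgroup.mem_normalizer_iff.1 n.2 x).1 hx

/-- An isomorphism in the fusion system from a morphism onto a given image. -/
theorem exists_mulEquiv {P Q : Subgroup S} {f : P →* S} (hf : f ∈ F.mor P) (h : f.range = Q) :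
    ∃ e : P ≃* Q, e.toMonoidHom ∈ F.Hom P Q ∧ ∀ x, (e x : S) = f x := by
  have hm : ∀ x, f x ∈ Q := fun x => h ▸ ⟨x, rfl⟩
  refine ⟨MulEquiv.ofBijective (f.codRestrict Q hm) ⟨fun x y hxy => ?_, fun y => ?_⟩,
    F.codRestrict_mem hf hm, fun x => rfl⟩
  · exact F.mor_injective hf (congrArg Subtype.val hxy)
  · obtain ⟨x, hx⟩ : (y : S) ∈ f.range := h ▸ y.2
    exact ⟨x, Subtype.ext hx⟩

theorem conj_iff {P Q : Subgroup S} : F.Conj P Q ↔ ∃ f ∈ F.mor P, f.range = Q := by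
  constructor
  · rintro ⟨φ, hφ, hb⟩
    refine ⟨_, F.subtype_comp_mem_mor hφ, ?_⟩
    rw [MonoidHom.range_comp, MonoidHom.range_eq_top.2 hb.2, ← MonoidHom.range_eq_map,
      Subgroup.range_subtype]
  · rintro ⟨f, hf, h⟩
    obtain ⟨e, he, -⟩ := F.exists_mulEquiv hf h
    exact ⟨_, he, e.bijective⟩

theorem conj_range {P : Subgroup S} {f : P →* S} (hf : f ∈ F.mor P) : F.Conj P f.range :=
  F.conj_iff.2 ⟨f, hf, rfl⟩

theorem Conj.card_eq {F : FusionSystem S} {P Q : Subgroup S} (h : F.Conj P Q) :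
    Nat.card P = Nat.card Q := by
  obtain ⟨φ, -, hb⟩ := h
  exact Nat.card_congr (Equiv.ofBijective φ hb)

theorem Conj.symm {F : FusionSystem S} {P Q : Subgroup S} (h : F.Conj P Q) : F.Conj Q P :=
  F.conjSetoid.symm h

theorem Conj.trans {F : FusionSystem S} {P Q R : Subgroup S} (h : F.Conj P Q) (h' : F.Conj Q R) :
    F.Conj P R :=
  F.conjSetoid.trans h h'

theorem Conj.refl (F : FusionSystem S) (P : Subgroup S) : F.Conj P P :=
  F.conjSetoid.refl P

theorem conj_map_conj (P : Subgroup S) (s : S) :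
    F.Conj P (P.map (MulAut.conj s).toMonoidHom) :=
  F.conj_iff.2 ⟨_, F.conj_comp_mem_mor (F.subtype_mem_mor P) s, by
    rw [MonoidHom.range_comp, Subgroup.range_subtype]⟩

theorem exists_aut_of_range_eq {P : Subgroup S} {f g : P →* S} (hf : f ∈ F.mor P)
    (hg : g ∈ F.mor P) (h : f.range = g.range) : ∃ α ∈ F.aut P, ∀ x, f (α x) = g x := by
  obtain ⟨e, he, hev⟩ := F.exists_mulEquiv hf rfl
  obtain ⟨d, hd, hdv⟩ := F.exists_mulEquiv hg h.symm
  refine ⟨d.trans e.symm, F.comp_mem hd (F.symm_mem e he), fun x => ?_⟩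
  rw [← hev, ← hdv]
  simp

theorem range_comp_mulEquiv {P Q : Subgroup S} (f : Q →* S) (e : P ≃* Q) :
    (f.comp e.toMonoidHom).range = f.range := by
  rw [MonoidHom.range_comp, MonoidHom.range_eq_top.2 e.surjective, ← MonoidHom.range_eq_map]

/-- Morphisms `Q → P` are counted by their images and the automorphisms of `Q`. -/
theorem card_hom (Q P : Subgroup S) :
    Nat.card (F.Hom Q P) =
      Nat.card (F.aut Q) * Nat.card {Q' : {Q' : Subgroup S // F.Conj Q Q'} // Q'.1 ≤ P} := by
  rw [Nat.card_congr (F.homEquiv Q P), ← Nat.card_prod]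
  -- One morphism is fixed for each image; any other morphism with that image differs from it by a
  -- unique automorphism of the source.
  choose f hf hfr using fun Q' : {Q' : Subgroup S // F.Conj Q Q'} => F.conj_iff.1 Q'.2
  symm
  have hrange : ∀ (Q') (α : MulAut Q), ((f Q').comp α.toMonoidHom).range = Q'.1 := fun Q' α => by
    rw [range_comp_mulEquiv, hfr]
  refine Nat.card_congr (Equiv.ofBijective (fun z => ⟨⟨(f z.2.1).comp z.1.1.toMonoidHom,
    F.mor_comp z.1.2 (hf _)⟩, fun x => z.2.2 (hrange z.2.1 z.1.1 ▸ ⟨x, rfl⟩)⟩) ⟨?_, ?_⟩)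
  · rintro ⟨⟨α, hα⟩, ⟨Q₁, h₁⟩⟩ ⟨⟨β, hβ⟩, ⟨Q₂, h₂⟩⟩ h
    have h' : (f Q₁).comp α.toMonoidHom = (f Q₂).comp β.toMonoidHom :=
      congrArg (fun g => g.1.1) h
    have hQ : Q₁ = Q₂ := Subtype.ext (by rw [← hrange Q₁ α, h', hrange])
    subst hQ
    have hαβ : α = β := by
      ext x : 1
      exact F.mor_injective (hf Q₁) (DFunLike.congr_fun h' x)
    subst hαβ
    rfl
  · rintro ⟨⟨g, hg⟩, hgP⟩
    let Q' : {Q' : Subgroup S // F.Conj Q Q'} := ⟨g.range, F.conj_range hg⟩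
    obtain ⟨α, hα, h⟩ := F.exists_aut_of_range_eq (hf Q') hg (hfr Q')
    refine ⟨⟨⟨α, hα⟩, ⟨Q', ?_⟩⟩, ?_⟩
    · rintro _ ⟨x, rfl⟩
      exact hgP x
    · refine Subtype.ext (Subtype.ext ?_)
      ext x
      exact h x

theorem card_mor_eq (Q : Subgroup S) :
    Nat.card (F.mor Q) = Nat.card (F.aut Q) * Nat.card {Q' : Subgroup S // F.Conj Q Q'} := by
  rw [card_mor, card_hom]
  congr 1
  exact Nat.card_congr (Equiv.subtypeUnivEquiv fun _ => le_top)

theorem card_mor_congr {P Q : Subgroup S} (h : F.Conj P Q) :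
    Nat.card (F.mor P) = Nat.card (F.mor Q) := by
  obtain ⟨f, hf, hr⟩ := F.conj_iff.1 h
  obtain ⟨e, he, -⟩ := F.exists_mulEquiv hf hr
  refine Nat.card_congr ⟨fun g => ⟨g.1.comp e.symm.toMonoidHom, F.mor_comp (F.symm_mem e he) g.2⟩,
    fun g => ⟨g.1.comp e.toMonoidHom, F.mor_comp he g.2⟩, fun g => ?_, fun g => ?_⟩
  · ext x; simp
  · ext x; simp

theorem exists_extension {p : ℕ} (hF : F.IsSaturated p) {P M : Subgroup S} {f : P →* S}
    (hf : f ∈ F.mor P) (hc : F.FullyCentralized f.range) (hPM : P ≤ M) (hM : M ≤ extender f) :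
    ∃ g ∈ F.mor M, g.comp (Subgroup.inclusion hPM) = f := by
  obtain ⟨φ, hφ, rfl⟩ := hf
  obtain ⟨ψ, hψ, h⟩ := hF.extend P φ hφ hc
  refine ⟨_, F.mor_restrict (F.subtype_comp_mem_mor hψ) hM, ?_⟩
  ext x
  exact congrArg Subtype.val (h x (Subgroup.inclusion hM (Subgroup.inclusion hPM x)) rfl)

theorem exists_fullyCentralized [Finite S] (P : Subgroup S) :
    ∃ Q, F.Conj P Q ∧ F.FullyCentralized Q := by
  have : Nonempty {Q // F.Conj P Q} := ⟨⟨P, Conj.refl F P⟩⟩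
  obtain ⟨Q, hQ⟩ := Finite.exists_max fun Q : {Q // F.Conj P Q} =>
    Nat.card (Subgroup.centralizer (Q.1 : Set S))
  exact ⟨Q.1, Q.2, fun R hR => hQ ⟨R, Q.2.trans hR⟩⟩

theorem exists_fullyNormalized [Finite S] (P : Subgroup S) :
    ∃ Q, F.Conj P Q ∧ F.FullyNormalized Q := by
  have : Nonempty {Q // F.Conj P Q} := ⟨⟨P, Conj.refl F P⟩⟩
  obtain ⟨Q, hQ⟩ := Finite.exists_max fun Q : {Q // F.Conj P Q} =>
    Nat.card (Subgroup.normalizer (Q.1 : Set S))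
  exact ⟨Q.1, Q.2, fun R hR => hQ ⟨R, Q.2.trans hR⟩⟩

/-! ### The `p`-part of the number of morphisms -/

/-- `S` acts on `F(P, S)` by conjugation in the target and `N_S(P)` by conjugation in the
source. -/
@[reducible] def morAction (P : Subgroup S) :
    MulAction (S × Subgroup.normalizer (P : Set S)) (F.mor P) where
  smul g f := ⟨(MulAut.conj g.1).toMonoidHom.comp
      (f.1.comp (P.normalizerMonoidHom g.2⁻¹).toMonoidHom),
    F.conj_comp_mem_mor (F.mor_comp (F.normalizerMonoidHom_mem_aut P _) f.2) _⟩
  one_smul f := by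
    refine Subtype.ext ?_
    ext x
    change 1 * f.1 (P.normalizerMonoidHom 1⁻¹ x) * 1⁻¹ = f.1 x
    simp
  mul_smul g h f := by
    refine Subtype.ext ?_
    ext x
    change (g.1 * h.1) * f.1 (P.normalizerMonoidHom (g.2 * h.2)⁻¹ x) * (g.1 * h.1)⁻¹ =
      g.1 * (h.1 * f.1 (P.normalizerMonoidHom h.2⁻¹ (P.normalizerMonoidHom g.2⁻¹ x)) * h.1⁻¹) * g.1⁻¹
    rw [mul_inv_rev, map_mul, MulAut.mul_apply]
    group

/-- The subgroup of automorphisms of `N` in the fusion system that fix `P` pointwise. -/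
def autFixing (N P : Subgroup S) : Subgroup (MulAut N) where
  carrier := {κ | κ ∈ F.aut N ∧ ∀ x : N, (x : S) ∈ P → κ x = x}
  one_mem' := ⟨one_mem _, fun _ _ => rfl⟩
  mul_mem' := fun {a b} ha hb => ⟨mul_mem ha.1 hb.1, fun x hx => by
    rw [MulAut.mul_apply, hb.2 x hx, ha.2 x hx]⟩
  inv_mem' := fun {a} ha => ⟨inv_mem ha.1, fun x hx => by
    rw [MulAut.inv_apply, MulEquiv.symm_apply_eq, ha.2 x hx]⟩

end FusionSystem

/-! ### Extending morphisms to normalizers, and bounds on `p`-parts. -/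

namespace FusionSystem

variable {S : Type u} [Group S] (F : FusionSystem S)

theorem FullyCentralized.card_centralizer_le {F : FusionSystem S} {P : Subgroup S}
    (hP : F.FullyCentralized P) {f : P →* S} (hf : f ∈ F.mor P) :
    Nat.card (Subgroup.centralizer (f.range : Set S)) ≤
      Nat.card (Subgroup.centralizer (P : Set S)) :=
  hP _ (F.conj_range hf)

/-- A morphism defined on `N_S(P)` maps the centralizer of a fully centralized `P` onto the
centralizer of the image of `P`. -/
theorem FullyCentralized.map_centralizer {F : FusionSystem S} [Finite S] {P : Subgroup S}
    (hP : F.FullyCentralized P) {g : Subgroup.normalizer (P : Set S) →* S} (hg : g ∈ F.mor _) :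
    ((Subgroup.centralizer (P : Set S)).subgroupOf (Subgroup.normalizer (P : Set S))).map g =
      Subgroup.centralizer ((g.comp (Subgroup.inclusion Subgroup.le_normalizer)).range : Set S) := by
  refine Subgroup.eq_of_le_of_card_ge ?_ ?_
  · rintro _ ⟨x, hx, rfl⟩ _ ⟨y, rfl⟩
    have := Subgroup.mem_subgroupOf.1 hx y y.2
    rw [MonoidHom.comp_apply, ← map_mul, ← map_mul]
    congr 1
    exact Subtype.ext this
  -- Equality is forced by order: since `P` is fully centralized, the centralizer of its image is no
  -- larger than that of `P`.
  · rw [Subgroup.card_map_of_injective (F.mor_injective hg),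
      Nat.card_congr (Subgroup.subgroupOfEquivOfLe
        (Subgroup.centralizer_le_normalizer (P : Set S))).toEquiv]
    exact hP.card_centralizer_le (F.mor_restrict hg _)

theorem FullyCentralized.card_centralizer_range {F : FusionSystem S} [Finite S] {P : Subgroup S}
    (hP : F.FullyCentralized P) {g : Subgroup.normalizer (P : Set S) →* S} (hg : g ∈ F.mor _) :
    Nat.card (Subgroup.centralizer
      ((g.comp (Subgroup.inclusion Subgroup.le_normalizer)).range : Set S)) =
      Nat.card (Subgroup.centralizer (P : Set S)) := by
  rw [← hP.map_centralizer hg, Subgroup.card_map_of_injective (F.mor_injective hg),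
    Nat.card_congr (Subgroup.subgroupOfEquivOfLe
        (Subgroup.centralizer_le_normalizer (P : Set S))).toEquiv]

/-- Two extensions of a morphism to `N_S(P)` differ by an automorphism fixing `P` pointwise. -/
theorem FullyCentralized.card_extensions {F : FusionSystem S} [Finite S] {P : Subgroup S}
    (hP : F.FullyCentralized P) {f : P →* S} {g : Subgroup.normalizer (P : Set S) →* S}
    (hg : g ∈ F.mor _) (hgf : g.comp (Subgroup.inclusion Subgroup.le_normalizer) = f) :
    Nat.card {h : F.mor (Subgroup.normalizer (P : Set S)) //
        h.1.comp (Subgroup.inclusion Subgroup.le_normalizer) = f} =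
      Nat.card (F.autFixing (Subgroup.normalizer (P : Set S)) P) := by
  symm
  refine Nat.card_congr (Equiv.ofBijective (fun κ => ⟨⟨g.comp κ.1.toMonoidHom,
    F.mor_comp κ.2.1 hg⟩, ?_⟩) ⟨?_, ?_⟩)
  · rw [← hgf]
    ext x
    exact congrArg g (κ.2.2 _ x.2)
  · intro κ κ' h
    have h' : g.comp κ.1.toMonoidHom = g.comp κ'.1.toMonoidHom := congrArg (fun a => a.1.1) h
    refine Subtype.ext ?_
    ext x : 1
    exact F.mor_injective hg (DFunLike.congr_fun h' x)
  -- Two extensions have the same image: `a x` and `b x` conjugate the image of `f` in the same way,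
  -- so they differ by an element centralizing it, and by `map_centralizer` such elements lie in the
  -- image of `b`.
  · have hle : ∀ {a b : Subgroup.normalizer (P : Set S) →* S}, a ∈ F.mor _ → b ∈ F.mor _ →
        a.comp (Subgroup.inclusion Subgroup.le_normalizer) = f →
        b.comp (Subgroup.inclusion Subgroup.le_normalizer) = f → a.range ≤ b.range := by
      rintro a b ha hb haf hbf _ ⟨x, rfl⟩
      have hc : a x * (b x)⁻¹ ∈ Subgroup.centralizer (f.range : Set S) := by
        rintro _ ⟨y, rfl⟩
        have hxy : (x : S)⁻¹ * y * x ∈ P := by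
          simpa using (Subgroup.mem_normalizer_iff.1 (inv_mem x.2) y).1 y.2
        have key : ∀ c : Subgroup.normalizer (P : Set S) →* S,
            c.comp (Subgroup.inclusion Subgroup.le_normalizer) = f →
            f y * c x = c x * f ⟨_, hxy⟩ := by
          rintro c rfl
          rw [MonoidHom.comp_apply, MonoidHom.comp_apply, ← map_mul, ← map_mul]
          congr 1
          refine Subtype.ext ?_
          simp [mul_assoc]
        have h1 := key a haf
        have h2 := key b hbf
        generalize f ⟨_, hxy⟩ = w at h1 h2
        rw [← mul_assoc, h1, eq_mul_inv_of_mul_eq h2]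
        group
      rw [← hbf, ← hP.map_centralizer hb] at hc
      obtain ⟨z, -, hz⟩ := hc
      exact ⟨z * x, by rw [map_mul, hz, inv_mul_cancel_right]⟩
    rintro ⟨⟨h, hh⟩, hhf⟩
    obtain ⟨κ, hκ, hκh⟩ := F.exists_aut_of_range_eq hg hh
      (le_antisymm (hle hg hh hgf hhf) (hle hh hg hhf hgf))
    refine ⟨⟨κ, hκ, fun x hx => F.mor_injective hg ?_⟩, ?_⟩
    · rw [hκh]
      exact DFunLike.congr_fun (hhf.trans hgf.symm) ⟨x, hx⟩
    · refine Subtype.ext (Subtype.ext ?_)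
      ext x
      exact hκh x

/-- `C_S(P)` acts on `N_S(P)` by conjugations fixing `P` pointwise, and the kernel of this action
embeds in the centralizer of `N_S(P)`. -/
theorem card_centralizer_dvd (P : Subgroup S) :
    Nat.card (Subgroup.centralizer (P : Set S)) ∣
      Nat.card (F.autFixing (Subgroup.normalizer (P : Set S)) P) *
        Nat.card (Subgroup.centralizer ((Subgroup.normalizer (P : Set S) : Subgroup S) : Set S)) := by
  set N : Subgroup S := Subgroup.normalizer (P : Set S) with hN
  have hCN : Subgroup.centralizer (P : Set S) ≤ N := Subgroup.centralizer_le_normalizer (P : Set S)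
  let c : Subgroup.centralizer (P : Set S) →* MulAut N :=
    MulAut.conj.comp (Subgroup.inclusion hCN)
  have hr : c.range ≤ F.autFixing N P := by
    rintro _ ⟨x, rfl⟩
    refine ⟨F.conj_mem N N x fun y hy => mul_mem (mul_mem (hCN x.2) hy) (inv_mem (hCN x.2)),
      fun y hy => ?_⟩
    refine Subtype.ext ?_
    change (x : S) * y * (x : S)⁻¹ = y
    rw [← x.2 y hy, mul_inv_cancel_right]
  have hk : Nat.card c.ker ∣ Nat.card (Subgroup.centralizer (N : Set S)) := by
    refine Subgroup.card_dvd_of_injective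
      ((Subgroup.subtype _).comp c.ker.subtype |>.codRestrict (Subgroup.centralizer (N : Set S)) ?_) ?_
    · rintro ⟨x, hx⟩ y hy
      have : (x : S) * y * (x : S)⁻¹ = y :=
        congrArg Subtype.val (DFunLike.congr_fun (MonoidHom.mem_ker.1 hx) (⟨y, hy⟩ : N))
      exact (mul_inv_eq_iff_eq_mul.1 this).symm
    · intro x y h
      have h' : ((x : Subgroup.centralizer (P : Set S)) : S) =
        (y : Subgroup.centralizer (P : Set S)) :=
        congrArg (Subgroup.centralizer (N : Set S)).subtype h
      exact Subtype.ext (Subtype.ext h')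
  rw [← Subgroup.index_mul_card c.ker, Subgroup.index_ker]
  exact mul_dvd_mul (Subgroup.card_dvd_of_le hr) hk

/-- For conjugation in the target alone, the stabilizer of `f` is the centralizer of its image. -/
theorem index_centralizer_eq_card_orbit (P : Subgroup S) (f : F.mor P) :
    letI := F.morAction P
    (Subgroup.centralizer (f.1.range : Set S)).index =
      (Set.range fun s : S => ((s, 1) : S × Subgroup.normalizer (P : Set S)) • f).ncard := by
  let := F.morAction P
  let : MulAction S (F.mor P) :=
    MulAction.compHom _ (MonoidHom.inl S (Subgroup.normalizer (P : Set S)))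
  rw [show Subgroup.centralizer (f.1.range : Set S) = MulAction.stabilizer S f from ?_,
    MulAction.index_stabilizer]
  · rfl
  · ext s
    have h : ∀ x, (((s, 1) : S × Subgroup.normalizer (P : Set S)) • f).1 x = s * f.1 x * s⁻¹ := by
      intro x
      change s * f.1 (P.normalizerMonoidHom 1⁻¹ x) * s⁻¹ = _
      simp
    constructor
    · intro hs
      refine Subtype.ext ?_
      ext x
      refine (h x).trans ?_
      rw [← hs (f.1 x) ⟨x, rfl⟩, mul_inv_cancel_right]
    · rintro hs _ ⟨x, rfl⟩
      have := (h x).symm.trans (congrArg (fun a : F.mor P => a.1 x) hs)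
      exact (mul_inv_eq_iff_eq_mul.1 this).symm

variable [Finite S] {p : ℕ} [hp : Fact p.Prime]

instance finite_mor (P : Subgroup S) : Finite (F.mor P) :=
  have : Finite (P →* S) := DFunLike.finite _
  inferInstance

/-- For a fully centralized `P`, the morphisms `P → S` whose orbit is as small as possible are
those that extend to `N_S(P)`. -/
theorem not_dvd_card_orbit_iff (hS : IsPGroup p S) (hF : F.IsSaturated p) {P : Subgroup S}
    (hP : F.FullyCentralized P) (f : F.mor P) :
    letI := F.morAction P
    (¬ p * (Subgroup.centralizer (P : Set S)).index ∣
      Nat.card (MulAction.orbit (S × Subgroup.normalizer (P : Set S)) f)) ↔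
      ∃ g : F.mor (Subgroup.normalizer (P : Set S)),
        g.1.comp (Subgroup.inclusion Subgroup.le_normalizer) = f.1 := by
  let := F.morAction P
  have hsub : (Set.range fun s : S => ((s, 1) : S × Subgroup.normalizer (P : Set S)) • f) ⊆
      MulAction.orbit (S × Subgroup.normalizer (P : Set S)) f := by
    rintro _ ⟨s, rfl⟩
    exact ⟨_, rfl⟩
  have hind := F.index_centralizer_eq_card_orbit P f
  have hcardP := Subgroup.card_mul_index (Subgroup.centralizer (P : Set S))
  have hcardf := Subgroup.card_mul_index (Subgroup.centralizer (f.1.range : Set S))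
  have hact : ∀ (s : S) (n : Subgroup.normalizer (P : Set S)) (x : P),
      ((s, n) • f).1 x = s * f.1 (P.normalizerMonoidHom n⁻¹ x) * s⁻¹ := fun _ _ _ => rfl
  constructor
  · intro h
    have hG : IsPGroup p (S × Subgroup.normalizer (P : Set S)) := by
      obtain ⟨a, ha⟩ := IsPGroup.iff_card.1 hS
      obtain ⟨b, hb⟩ := IsPGroup.iff_card.1 (hS.to_subgroup (Subgroup.normalizer (P : Set S)))
      exact IsPGroup.of_card (n := a + b) (by rw [Nat.card_prod, ha, hb, pow_add])
    obtain ⟨a, ha⟩ := hG.card_orbit f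
    obtain ⟨b, hb⟩ := hS.index (Subgroup.centralizer (P : Set S))
    -- Both numbers are powers of `p`, so failing to be divisible by the next power bounds the orbit
    -- by `|S : C_S(P)|`.
    have hab : a ≤ b := by
      by_contra! hlt
      refine h ?_
      rw [ha, hb, ← pow_succ']
      exact pow_dvd_pow p hlt
    have hle : Nat.card (MulAction.orbit (S × Subgroup.normalizer (P : Set S)) f) ≤
        (Subgroup.centralizer (P : Set S)).index := by
      rw [ha, hb]
      exact Nat.pow_le_pow_right hp.out.pos hab
    have hle' : (Subgroup.centralizer (P : Set S)).index ≤
        (Subgroup.centralizer (f.1.range : Set S)).index := by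
      have h1 := hP.card_centralizer_le f.2
      have h2 : 0 < Nat.card (Subgroup.centralizer (P : Set S)) := Nat.card_pos
      refine le_of_mul_le_mul_left ?_ h2
      rw [hcardP, ← hcardf]
      exact Nat.mul_le_mul_right _ h1
    -- The orbit under `S` alone already has at least `|S : C_S(P)|` elements, as `P` is fully
    -- centralized, so it is the full orbit.
    have heq := Set.eq_of_subset_of_ncard_le hsub (by
      rw [← hind]
      exact hle.trans hle')
    have hfc : F.FullyCentralized f.1.range := by
      have hle'' : (Subgroup.centralizer (f.1.range : Set S)).index ≤
          (Subgroup.centralizer (P : Set S)).index := by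
        rw [hind, heq]
        exact hle
      intro R hR
      have h3 : Nat.card (Subgroup.centralizer (P : Set S)) ≤
          Nat.card (Subgroup.centralizer (f.1.range : Set S)) := by
        have h2 : 0 < (Subgroup.centralizer (P : Set S)).index :=
          Nat.pos_of_ne_zero Subgroup.index_ne_zero_of_finite
        refine le_of_mul_le_mul_right ?_ h2
        rw [hcardP, ← hcardf]
        exact Nat.mul_le_mul_left _ hle''
      exact (hP R ((F.conj_range f.2).trans hR)).trans h3
    -- Since the `S`-orbit is everything, conjugating the source by `n` equals conjugating the
    -- target by some `s`, which is the condition defining `extender`.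
    have hext : Subgroup.normalizer (P : Set S) ≤ extender f.1 := by
      intro n hn
      refine ⟨hn, ?_⟩
      obtain ⟨s, hs⟩ : ((1, ⟨n, hn⟩⁻¹) : S × Subgroup.normalizer (P : Set S)) • f ∈
          Set.range fun s : S => ((s, 1) : S × Subgroup.normalizer (P : Set S)) • f := by
        rw [heq]
        exact ⟨_, rfl⟩
      refine ⟨s, fun g h hgh => ?_⟩
      have := congrArg (fun a : F.mor P => a.1 g) hs
      simp only [hact] at this
      simp only [inv_one, map_one, MulAut.one_apply, inv_inv, one_mul, mul_one] at this
      rw [this]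
      congr 1
      exact Subtype.ext hgh
    obtain ⟨g, hg, h⟩ := F.exists_extension hF f.2 hfc Subgroup.le_normalizer hext
    exact ⟨⟨g, hg⟩, h⟩
  · rintro ⟨g, hg⟩ hdvd
    have hsub' : MulAction.orbit (S × Subgroup.normalizer (P : Set S)) f ⊆
        Set.range fun s : S => ((s, 1) : S × Subgroup.normalizer (P : Set S)) • f := by
      rintro _ ⟨⟨s, n⟩, rfl⟩
      -- An extension `g` turns conjugation by `n⁻¹` in the source into conjugation by its value in
      -- the target.
      refine ⟨s * g.1 n⁻¹, Subtype.ext ?_⟩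
      ext x
      change ((s * g.1 n⁻¹, 1) • f).1 x = ((s, n) • f).1 x
      rw [hact, hact, ← hg]
      have : Subgroup.inclusion Subgroup.le_normalizer (P.normalizerMonoidHom n⁻¹ x) =
          n⁻¹ * Subgroup.inclusion (Subgroup.le_normalizer (H := P)) x * n := by
        refine Subtype.ext ?_
        change (n : S)⁻¹ * x * (n : S)⁻¹⁻¹ = _
        simp
      rw [MonoidHom.comp_apply, MonoidHom.comp_apply, this]
      simp [mul_assoc]
    have hcard : Nat.card (MulAction.orbit (S × Subgroup.normalizer (P : Set S)) f) =
        (Subgroup.centralizer (P : Set S)).index := by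
      change (MulAction.orbit (S × Subgroup.normalizer (P : Set S)) f).ncard = _
      rw [hsub'.antisymm hsub, ← hind]
      have hc := hP.card_centralizer_range g.2
      rw [hg] at hc
      rw [hc, ← hcardP] at hcardf
      exact Nat.eq_of_mul_eq_mul_left Nat.card_pos hcardf
    rw [hcard] at hdvd
    have h2 : 0 < (Subgroup.centralizer (P : Set S)).index :=
      Nat.pos_of_ne_zero Subgroup.index_ne_zero_of_finite
    have := Nat.le_of_dvd h2 hdvd
    nlinarith [hp.out.two_le]

theorem card_aut_top : Nat.card (F.mor ⊤) = Nat.card (F.aut ⊤) := by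
  rw [card_mor_eq]
  have : Unique {Q' : Subgroup S // F.Conj ⊤ Q'} :=
    { default := ⟨⊤, Conj.refl F ⊤⟩
      uniq := fun Q => Subtype.ext (Subgroup.eq_top_of_card_eq _ (by
        rw [← Q.2.card_eq, Subgroup.card_top])) }
  rw [Nat.card_unique (α := {Q' : Subgroup S // F.Conj ⊤ Q'}), mul_one]

/-- The `p`-part of `|F(P, S)|` divides `|S : C_S(P)|`. -/
theorem not_dvd_card_mor (hS : IsPGroup p S) (hF : F.IsSaturated p) (P : Subgroup S) :
    ¬ p * Nat.card S ∣ Nat.card (F.mor P) * Nat.card (Subgroup.centralizer (P : Set S)) := by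
  -- Induction on `|S| - |P|`. Replacing `P` by a fully centralized conjugate keeps `|F(P,S)|` and
  -- only enlarges the centralizer, so the assumed divisibility survives.
  induction h : Nat.card S - Nat.card P using Nat.strong_induction_on generalizing P with
  | _ n ih =>
    subst h
    intro hdvd
    obtain ⟨Q, hPQ, hQ⟩ := F.exists_fullyCentralized P
    have hdvdQ : p * Nat.card S ∣
        Nat.card (F.mor Q) * Nat.card (Subgroup.centralizer (Q : Set S)) := by
      rw [← F.card_mor_congr hPQ]
      refine hdvd.trans (mul_dvd_mul_left _ ?_)
      obtain ⟨a, ha⟩ := IsPGroup.iff_card.1 (hS.to_subgroup (Subgroup.centralizer (P : Set S)))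
      obtain ⟨b, hb⟩ := IsPGroup.iff_card.1 (hS.to_subgroup (Subgroup.centralizer (Q : Set S)))
      have hab := hQ P hPQ.symm
      rw [ha, hb] at hab ⊢
      exact pow_dvd_pow p ((Nat.pow_le_pow_iff_right hp.out.one_lt).1 hab)
    rcases eq_or_ne Q ⊤ with rfl | hne
    · have hfn : F.FullyNormalized ⊤ := by
        intro R hR
        rw [Subgroup.normalizer_eq_top (⊤ : Subgroup S), Subgroup.card_top]
        exact Subgroup.card_le_card_group _
      -- At `S` itself the morphisms are automorphisms, and the inner ones form a Sylow subgroup,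
      -- whose index is prime to `p`.
      obtain ⟨-, T, hT⟩ := hF.sylow ⊤ hfn
      have hTcard : Nat.card T = Nat.card (⊤ : Subgroup S).normalizerMonoidHom.range := by
        rw [← hT]
        exact (Subgroup.card_map_of_injective Subtype.val_injective).symm
      have hcard := card_range_normalizerMonoidHom_mul (⊤ : Subgroup S)
      rw [← hTcard, Subgroup.normalizer_eq_top, Subgroup.card_top] at hcard
      rw [← hcard, card_aut_top, ← mul_assoc] at hdvdQ
      have hdvdT := Nat.dvd_of_mul_dvd_mul_right Nat.card_pos hdvdQ
      rw [← Subgroup.card_mul_index (T : Subgroup (F.aut ⊤)), mul_comm p] at hdvdT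
      exact T.not_dvd_index (Nat.dvd_of_mul_dvd_mul_left Nat.card_pos hdvdT)
    · let := F.morAction Q
      have := hS.isNilpotent
      have hlt : Q < Subgroup.normalizer (Q : Set S) :=
        Group.normalizerCondition_of_isNilpotent Q (lt_top_iff_ne_top.2 hne)
      have hcardlt : Nat.card Q < Nat.card (Subgroup.normalizer (Q : Set S)) :=
        Set.ncard_lt_ncard hlt
      have hN : Nat.card (Subgroup.normalizer (Q : Set S)) ≤ Nat.card S :=
        Subgroup.card_le_card_group _
      refine ih _ ?_ (Subgroup.normalizer (Q : Set S)) rfl ?_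
      · rw [hPQ.card_eq]
        omega
      have hdvd1 : p * (Subgroup.centralizer (Q : Set S)).index ∣ Nat.card (F.mor Q) := by
        rw [← Subgroup.index_mul_card (Subgroup.centralizer (Q : Set S)), ← mul_assoc] at hdvdQ
        exact Nat.dvd_of_mul_dvd_mul_right Nat.card_pos hdvdQ
      have hdvd2 := dvd_card_setOf_not_dvd_card_orbit
        (S × Subgroup.normalizer (Q : Set S)) (F.mor Q) hdvd1
      -- Restriction from `N_S(Q)` to `Q` lands exactly on the morphisms in small orbits, and all
      -- its fibres have the same size.
      have hfib : Nat.card (F.mor (Subgroup.normalizer (Q : Set S))) =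
          Nat.card {f : F.mor Q // ¬ p * (Subgroup.centralizer (Q : Set S)).index ∣
            Nat.card (MulAction.orbit (S × Subgroup.normalizer (Q : Set S)) f)} *
          Nat.card (F.autFixing (Subgroup.normalizer (Q : Set S)) Q) := by
        let res : F.mor (Subgroup.normalizer (Q : Set S)) →
            {f : F.mor Q // ¬ p * (Subgroup.centralizer (Q : Set S)).index ∣
              Nat.card (MulAction.orbit (S × Subgroup.normalizer (Q : Set S)) f)} :=
          fun g => ⟨⟨_, F.mor_restrict g.2 Subgroup.le_normalizer⟩,
            (F.not_dvd_card_orbit_iff hS hF hQ _).2 ⟨g, rfl⟩⟩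
        have := Fintype.ofFinite {f : F.mor Q // ¬ p * (Subgroup.centralizer (Q : Set S)).index ∣
              Nat.card (MulAction.orbit (S × Subgroup.normalizer (Q : Set S)) f)}
        rw [← Nat.card_congr (Equiv.sigmaFiberEquiv res), Nat.card_sigma]
        rw [Finset.sum_const_nat (m := Nat.card (F.autFixing (Subgroup.normalizer (Q : Set S)) Q)),
          Finset.card_univ, ← Nat.card_eq_fintype_card]
        rintro ⟨f, hf⟩ -
        obtain ⟨g, hg⟩ := (F.not_dvd_card_orbit_iff hS hF hQ f).1 hf
        rw [← hQ.card_extensions g.2 hg]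
        refine Nat.card_congr (Equiv.subtypeEquivRight fun h => ?_)
        rw [Subtype.ext_iff, Subtype.ext_iff]
      rw [hfib, ← Subgroup.index_mul_card (Subgroup.centralizer (Q : Set S)), ← mul_assoc,
        mul_assoc (Nat.card {f : F.mor Q // _})]
      -- The excess factor `p` passes from `Q` to the strictly larger `N_S(Q)`, contradicting the
      -- induction hypothesis.
      exact mul_dvd_mul hdvd2 (F.card_centralizer_dvd Q)

/-- The `p`-part of the number of conjugates of `P` divides `|S : N_S(P)|`. -/
theorem not_dvd_card_conj (hS : IsPGroup p S) (hF : F.IsSaturated p) (P : Subgroup S) :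
    ¬ p * Nat.card S ∣ Nat.card {Q : Subgroup S // F.Conj P Q} *
      Nat.card (Subgroup.normalizer (P : Set S)) := by
  intro h
  refine F.not_dvd_card_mor hS hF P (h.trans ?_)
  -- `|F(P,S)|` is `|Aut_F(P)|` times the class size, `|N_S(P)|` is `|Aut_S(P)||C_S(P)|`, and
  -- `|Aut_S(P)|` divides `|Aut_F(P)|`.
  rw [card_mor_eq, ← card_range_normalizerMonoidHom_mul, mul_comm (Nat.card (F.aut P)), mul_assoc]
  refine mul_dvd_mul_left _ (mul_dvd_mul_right (Subgroup.card_dvd_of_le ?_) _)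
  rintro _ ⟨n, rfl⟩
  exact F.normalizerMonoidHom_mem_aut P n

/-- A conjugate `Q` of a fully normalized `P` is mapped onto `P` by a morphism defined on
`N_S(Q)`. -/
theorem exists_mor_normalizer (hS : IsPGroup p S) (hF : F.IsSaturated p) {P Q : Subgroup S}
    (hP : F.FullyNormalized P) (hQP : F.Conj Q P) :
    ∃ f ∈ F.mor (Subgroup.normalizer (Q : Set S)),
      (Q.subgroupOf (Subgroup.normalizer (Q : Set S))).map f = P := by
  obtain ⟨hPc, T, hT⟩ := hF.sylow P hP
  obtain ⟨f, hf, hr⟩ := F.conj_iff.1 hQP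
  obtain ⟨e, he, hev⟩ := F.exists_mulEquiv hf hr
  -- Transport of `Aut_S(Q)` along `e` gives a `p`-subgroup of `Aut_F(P)`. Sylow's theorem supplies
  -- `χ` conjugating it into `Aut_S(P)`, which is what makes `χ ∘ e` extend to all of `N_S(Q)`.
  let c : Subgroup.normalizer (Q : Set S) →* F.aut P :=
    { toFun := fun n => ⟨(e.symm.trans (Q.normalizerMonoidHom n)).trans e,
        F.comp_mem (F.comp_mem (F.symm_mem e he) (F.normalizerMonoidHom_mem_aut Q n)) he⟩
      map_one' := by
        refine Subtype.ext ?_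
        ext x
        simp
      map_mul' := fun a b => by
        refine Subtype.ext ?_
        ext x
        simp }
  have hc : IsPGroup p c.range :=
    (hS.to_subgroup (Subgroup.normalizer (Q : Set S))).of_surjective c.rangeRestrict
      c.rangeRestrict_surjective
  obtain ⟨T', hT'⟩ := hc.exists_le_sylow
  obtain ⟨χ, hχ⟩ := MulAction.exists_smul_eq (F.aut P) T' T
  have hχe : (e.trans χ.1).toMonoidHom ∈ F.Hom Q P := F.comp_mem he χ.2
  have hrange : (P.subtype.comp (e.trans χ.1).toMonoidHom).range = P := by
    rw [range_comp_mulEquiv, Subgroup.range_subtype]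
  obtain ⟨g, hg, hgf⟩ := F.exists_extension hF (F.subtype_comp_mem_mor hχe) (by rwa [hrange])
    Subgroup.le_normalizer (M := Subgroup.normalizer (Q : Set S)) (by
      intro n hn
      refine ⟨hn, ?_⟩
      have h1 : χ * c ⟨n, hn⟩ * χ⁻¹ ∈ T := by
        rw [← hχ]
        exact ⟨c ⟨n, hn⟩, hT' ⟨_, rfl⟩, rfl⟩
      have h2 : (χ * c ⟨n, hn⟩ * χ⁻¹).1 ∈ P.normalizerMonoidHom.range := by
        rw [← hT]
        exact ⟨_, h1, rfl⟩
      obtain ⟨y, hy⟩ := h2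
      refine ⟨y, fun a b hab => ?_⟩
      have h3 := congrArg Subtype.val (DFunLike.congr_fun hy (χ.1 (e a)))
      have hb : b = Q.normalizerMonoidHom ⟨n, hn⟩ a := Subtype.ext hab
      have h4 : (χ * c ⟨n, hn⟩ * χ⁻¹).1 (χ.1 (e a)) = χ.1 (e b) := by
        rw [hb]
        change χ.1 (e (Q.normalizerMonoidHom ⟨n, hn⟩ (e.symm (χ.1.symm (χ.1 (e a)))))) = _
        simp
      rw [h4] at h3
      exact h3.symm)
  refine ⟨g, hg, ?_⟩
  rw [← hrange, ← hgf, MonoidHom.range_comp, Subgroup.inclusion_range]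

end FusionSystem

/-! ### Sums over subgroups and over conjugacy classes of subgroups -/

theorem card_conj_class_eq_index {S : Type u} [Group S] (K : Subgroup S) :
    Nat.card {R : Subgroup S // (subgroupConjSetoid S).r K R} =
      (Subgroup.normalizer (K : Set S)).index := by
  let : MulAction S (Subgroup S) :=
    { smul := fun s R => R.map (MulAut.conj s).toMonoidHom
      one_smul := fun R => by
        change R.map (MulAut.conj (1 : S)).toMonoidHom = R
        ext; simp
      mul_smul := fun s t R => by
        change R.map (MulAut.conj (s * t)).toMonoidHom =
          (R.map (MulAut.conj t).toMonoidHom).map (MulAut.conj s).toMonoidHom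
        rw [Subgroup.map_map]
        congr 1
        ext x
        simp }
  have h : Subgroup.normalizer (K : Set S) = MulAction.stabilizer S K := by
    ext s
    exact Subgroup.mem_normalizer_iff_map_conj_eq
  rw [h, MulAction.index_stabilizer]
  rfl

/-- Each `S`-class contributes `|S : N_S(R)|` equal terms. These weights later cancel against the
normalizers in `Φ_R(S/R)`. -/
theorem sum_subgroup_eq_sum_class {S : Type u} [Group S] [Finite S] [Fintype (Subgroup S)]
    [Fintype (Quotient (subgroupConjSetoid S))] (g : Subgroup S → ℚ)
    (hg : ∀ R s, g (R.map (MulAut.conj s).toMonoidHom) = g R) :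
    ∑ R, g R = ∑ r : Quotient (subgroupConjSetoid S),
      (Nat.card S / Nat.card (Subgroup.normalizer (r.out : Set S)) : ℚ) * g r.out := by
  classical
  rw [← Finset.sum_fiberwise Finset.univ (fun R => Quotient.mk (subgroupConjSetoid S) R) g]
  refine Finset.sum_congr rfl fun r _ => ?_
  have hconj : ∀ R : Subgroup S, Quotient.mk (subgroupConjSetoid S) R = r ↔
      (subgroupConjSetoid S).r r.out R := fun R => by
    conv_lhs => rw [← Quotient.out_eq r]
    exact Quotient.eq.trans ⟨(subgroupConjSetoid S).symm, (subgroupConjSetoid S).symm⟩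
  rw [Finset.sum_congr rfl (g := fun _ => g r.out), Finset.sum_const, nsmul_eq_mul]
  · congr 1
    rw [eq_div_iff (by exact_mod_cast Nat.card_pos.ne'), ← Nat.cast_mul,
      ← Subgroup.index_mul_card (Subgroup.normalizer (r.out : Set S)), ← card_conj_class_eq_index,
      Nat.card_eq_fintype_card (α := {R : Subgroup S // (subgroupConjSetoid S).r r.out R}),
      Fintype.card_subtype]
    simp only [hconj]
  · intro R hR
    obtain ⟨s, hs⟩ := (hconj R).1 (Finset.mem_filter.1 hR).2
    rw [← hs, hg]

/-- The hypothesis bounds the `p`-adic valuation of `b` by `k`, so the numerator absorbs the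
`p`-part of the denominator. -/
theorem ZLocal.div_mem_of_not_dvd {p : ℕ} [hp : Fact p.Prime] {a b k : ℕ} (ha : a = p ^ k)
    (hb : ¬ p * a ∣ b) : (a / b : ℚ) ∈ ZLocal p := by
  have hb0 : b ≠ 0 := by rintro rfl; exact hb (dvd_zero _)
  obtain ⟨j, c, hc, rfl⟩ := Nat.exists_eq_pow_mul_and_not_dvd hb0 p hp.out.ne_one
  have hjk : j ≤ k := by
    by_contra! hlt
    refine hb (Dvd.dvd.mul_right ?_ c)
    rw [ha, ← pow_succ']
    exact pow_dvd_pow p hlt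
  have hp0 : (p : ℚ) ≠ 0 := by exact_mod_cast hp.out.ne_zero
  have : (a / (p ^ j * c : ℕ) : ℚ) = (p ^ (k - j) : ℕ) * (c : ℚ)⁻¹ := by
    rw [ha]
    push_cast
    rw [pow_sub₀ _ hp0 hjk, div_eq_mul_inv, mul_inv, mul_assoc]
  rw [this]
  exact mul_mem (natCast_mem _ _) (ZLocal.inv_natCast_mem p hc)

namespace FusionSystem

variable {S : Type u} [Group S] (F : FusionSystem S)

theorem conj_map {P : Subgroup S} {f : P →* S} (hf : f ∈ F.mor P) (Q : Subgroup P) :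
    F.Conj (Q.map P.subtype) (Q.map f) := by
  refine F.conj_iff.2 ⟨_, F.mor_restrict hf (Subgroup.map_subtype_le Q), ?_⟩
  ext y
  constructor
  · rintro ⟨⟨_, x, hx, rfl⟩, rfl⟩
    exact ⟨x, hx, rfl⟩
  · rintro ⟨x, hx, rfl⟩
    exact ⟨⟨_, x, hx, rfl⟩, rfl⟩

theorem card_hom_congr {P P' : Subgroup S} (Q : Subgroup S) (h : F.Conj P P') :
    Nat.card (F.Hom Q P) = Nat.card (F.Hom Q P') := by
  obtain ⟨f, hf, hr⟩ := F.conj_iff.1 h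
  obtain ⟨e, he, -⟩ := F.exists_mulEquiv hf hr
  refine Nat.card_congr ⟨fun g => ⟨e.toMonoidHom.comp g.1, F.comp_mem g.2 he⟩,
    fun g => ⟨e.symm.toMonoidHom.comp g.1, F.comp_mem g.2 (F.symm_mem e he)⟩,
    fun g => ?_, fun g => ?_⟩
  · refine Subtype.ext ?_
    ext x; simp
  · refine Subtype.ext ?_
    ext x; simp

theorem conj_left_eq {F : FusionSystem S} {Q R : Subgroup S} (h : F.Conj Q R) :
    F.Conj Q = F.Conj R :=
  funext fun _ => propext ⟨h.symm.trans, h.trans⟩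

/-! ### Averaging over conjugacy classes -/

variable [Finite S]

/-- The average of a function on subgroups over the `F`-conjugacy class of `Q`. -/
noncomputable def average (Q : Subgroup S) : (Subgroup S → ℚ) →ₗ[ℚ] ℚ where
  toFun f := 1 / (Nat.card {Q' : Subgroup S // F.Conj Q Q'} : ℚ) *
    ∑ᶠ Q' : {Q' : Subgroup S // F.Conj Q Q'}, f Q'.1
  map_add' f g := by
    rw [← mul_add, ← finsum_add_distrib (Set.toFinite _) (Set.toFinite _)]
    rfl
  map_smul' c f := by
    rw [RingHom.id_apply, smul_eq_mul, mul_left_comm, mul_finsum (f := fun _ => _) c]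
    rfl

theorem average_apply (Q : Subgroup S) (f : Subgroup S → ℚ) :
    F.average Q f = 1 / (Nat.card {Q' : Subgroup S // F.Conj Q Q'} : ℚ) *
      ∑ᶠ Q' : {Q' : Subgroup S // F.Conj Q Q'}, f Q'.1 := rfl

theorem card_conj_ne_zero (Q : Subgroup S) :
    (Nat.card {Q' : Subgroup S // F.Conj Q Q'} : ℚ) ≠ 0 := by
  have : Nonempty {Q' : Subgroup S // F.Conj Q Q'} := ⟨⟨Q, Conj.refl F Q⟩⟩
  exact_mod_cast Nat.card_pos.ne'

theorem average_congr {Q R : Subgroup S} (h : F.Conj Q R) : F.average Q = F.average R := by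
  ext f
  rw [average_apply, average_apply, conj_left_eq h]

theorem average_eq_self {Q : Subgroup S} {f : Subgroup S → ℚ}
    (h : ∀ Q', F.Conj Q Q' → f Q' = f Q) : F.average Q f = f Q := by
  have := Fintype.ofFinite {Q' : Subgroup S // F.Conj Q Q'}
  have h0 := F.card_conj_ne_zero Q
  rw [average_apply, finsum_congr (g := fun _ => f Q) fun Q' : {Q' : Subgroup S // F.Conj Q Q'} =>
    h Q'.1 Q'.2, finsum_eq_sum_of_fintype,
    Finset.sum_const, Finset.card_univ, ← Nat.card_eq_fintype_card, nsmul_eq_mul]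
  field_simp

open Classical in
theorem average_eq_sum [Fintype (Subgroup S)] (Q : Subgroup S) (f : Subgroup S → ℚ) :
    F.average Q f = 1 / (Nat.card {Q' : Subgroup S // F.Conj Q Q'} : ℚ) *
      ∑ R, if F.Conj Q R then f R else 0 := by
  rw [average_apply, finsum_eq_sum_of_fintype, ← Finset.sum_filter,
    Finset.sum_subtype (p := fun R => F.Conj Q R) _ (by simp)]

/-- Deviations from the average sum to zero over each `F`-class, and `h` is constant there. This is
why the corrections preserve all averages. -/
theorem sum_average_sub_mul [Fintype (Subgroup S)] (f h : Subgroup S → ℚ)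
    (hh : ∀ Q R, F.Conj Q R → h Q = h R) : ∑ R, (F.average R f - f R) * h R = 0 := by
  classical
  simp only [sub_mul, Finset.sum_sub_distrib, sub_eq_zero]
  simp only [average_eq_sum, Finset.mul_sum, Finset.sum_mul]
  rw [Finset.sum_comm]
  refine Finset.sum_congr rfl fun R _ => ?_
  have h0 := F.card_conj_ne_zero R
  calc _ = ∑ Q, if F.Conj R Q then
          1 / (Nat.card {Q' : Subgroup S // F.Conj R Q'} : ℚ) * (f R * h R) else 0 := by
        refine Finset.sum_congr rfl fun Q _ => ?_
        by_cases hQR : F.Conj Q R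
        · rw [if_pos hQR, if_pos hQR.symm, hh Q R hQR, conj_left_eq hQR, mul_assoc]
        · rw [if_neg hQR, if_neg fun h => hQR h.symm, mul_zero, zero_mul]
    _ = F.average R fun _ => f R * h R := by
        rw [average_eq_sum, Finset.mul_sum]
        simp
    _ = f R * h R := F.average_eq_self fun _ _ => rfl

/-- Counts pairs of a conjugate `R` of `Q` and `s` with `s⁻¹Rs ≤ P`. Replacing `R` by `s⁻¹Rs`, again
a conjugate of `Q`, decouples them into `|S|` times the number of conjugates inside `P`, which
`card_hom` relates to `|F(Q,P)|`. -/
theorem average_mark_coset (Q P : Subgroup S) :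
    F.average Q (fun R => (BurnsideRing.mark R (BurnsideRing.coset P) : ℚ)) =
      (Nat.card (F.Hom Q P) * Nat.card S : ℚ) / (Nat.card P * Nat.card (F.Hom Q ⊤)) := by
  have := Fintype.ofFinite {Q' : Subgroup S // F.Conj Q Q'}
  have hsum : (∑ Q' : {Q' : Subgroup S // F.Conj Q Q'},
      FinGSet.fixedCard Q'.1 (FinGSet.coset P)) * Nat.card P =
      Nat.card S * Nat.card {Q' : {Q' : Subgroup S // F.Conj Q Q'} // Q'.1 ≤ P} := by
    rw [Finset.sum_mul]
    simp only [fixedCard_coset_mul_card]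
    rw [← Nat.card_sigma, ← Nat.card_prod]
    have hmap : ∀ (s : S) (R : Subgroup S), (R.map (MulAut.conj s).toMonoidHom).map
        (MulAut.conj s⁻¹).toMonoidHom = R := fun s R => by
      rw [Subgroup.map_map]
      ext x
      simp [mul_assoc]
    refine Nat.card_congr
      { toFun := fun z => (z.2.1, ⟨⟨z.1.1.map (MulAut.conj z.2.1⁻¹).toMonoidHom,
          z.1.2.trans (F.conj_map_conj _ _)⟩, z.2.2⟩)
        invFun := fun z => ⟨⟨z.2.1.1.map (MulAut.conj z.1).toMonoidHom,
          z.2.1.2.trans (F.conj_map_conj _ _)⟩, ⟨z.1, (hmap z.1 z.2.1.1).trans_le z.2.2⟩⟩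
        left_inv := ?_
        right_inv := ?_ }
    · rintro ⟨⟨R, hR⟩, ⟨s, hs⟩⟩
      have h' : (R.map (MulAut.conj s⁻¹).toMonoidHom).map (MulAut.conj s).toMonoidHom = R := by
        simpa using hmap s⁻¹ R
      simp only
      congr 1
      · exact Subtype.ext h'
      · congr 1
        · funext t
          rw [h']
        · exact proof_irrel_heq _ _
    · rintro ⟨s, ⟨⟨R, hR⟩, hle⟩⟩
      simp only [Prod.mk.injEq, true_and, Subtype.mk.injEq]
      exact hmap s R
  have haut : (Nat.card (F.aut Q) : ℚ) ≠ 0 := by exact_mod_cast Nat.card_pos.ne'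
  have hP : (Nat.card P : ℚ) ≠ 0 := by exact_mod_cast Nat.card_pos.ne'
  have h0 := F.card_conj_ne_zero Q
  rw [← card_mor, card_mor_eq, card_hom, average_apply, finsum_eq_sum_of_fintype]
  simp only [BurnsideRing.mark_coset, Int.cast_natCast]
  rw [← Nat.cast_sum]
  have hsum' := congrArg (Nat.cast : ℕ → ℚ) hsum
  push_cast at hsum' ⊢
  field_simp
  rw [hsum']
  ring

theorem average_mark_coset_congr {P P' : Subgroup S} (Q : Subgroup S) (h : F.Conj P P') :
    F.average Q (fun R => (BurnsideRing.mark R (BurnsideRing.coset P) : ℚ)) =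
      F.average Q (fun R => (BurnsideRing.mark R (BurnsideRing.coset P') : ℚ)) := by
  rw [average_mark_coset, average_mark_coset, F.card_hom_congr Q h, h.card_eq]

end FusionSystem

namespace FusionSystem

variable {S : Type u} [Group S] (F : FusionSystem S) {p : ℕ} [hp : Fact p.Prime]

/-! ### Stability in terms of marks -/

theorem mark_eq_of_mem_burnsideRing {x : BurnsideRing S} (hx : x ∈ F.burnsideRing)
    {Q Q' : Subgroup S} (h : F.Conj Q Q') : BurnsideRing.mark Q' x = BurnsideRing.mark Q x := by
  obtain ⟨φ, hφ, rfl⟩ := F.conj_iff.1 h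
  obtain ⟨φ, hφ, rfl⟩ := hφ
  -- The mark at the whole of `Q` of a restriction along `φ` is the mark at the image of `φ`.
  have := congrArg (BurnsideRing.mark ⊤) (hx Q φ hφ)
  rwa [BurnsideRing.mark_res, BurnsideRing.mark_res, ← MonoidHom.range_eq_map,
    ← MonoidHom.range_eq_map, Subgroup.range_subtype] at this

theorem mark_eq_of_mem_localBurnsideRing {X : LocalBurnsideRing p S}
    (hX : X ∈ F.localBurnsideRing p) {Q Q' : Subgroup S} (h : F.Conj Q Q') :
    (LocalBurnsideRing.mark p Q' X : ℚ) = LocalBurnsideRing.mark p Q X := by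
  obtain ⟨Y, rfl⟩ := hX
  induction Y using TensorProduct.induction_on with
  | zero => simp
  | tmul z y =>
    change (LocalBurnsideRing.mark p Q' (z ⊗ₜ (y : BurnsideRing S)) : ℚ) =
      LocalBurnsideRing.mark p Q (z ⊗ₜ (y : BurnsideRing S))
    rw [LocalBurnsideRing.mark_tmul, LocalBurnsideRing.mark_tmul,
      F.mark_eq_of_mem_burnsideRing y.2 h]
  | add Y Z hY hZ => simp only [map_add, Subring.coe_add, hY, hZ]

variable [Finite S]

/-- After clearing the denominator, the two restrictions along a morphism have equal marks at every
subgroup of its source, hence agree. -/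
theorem mem_localBurnsideRing_of_mark_eq {X : LocalBurnsideRing p S}
    (h : ∀ Q Q', F.Conj Q Q' →
      (LocalBurnsideRing.mark p Q' X : ℚ) = LocalBurnsideRing.mark p Q X) :
    X ∈ F.localBurnsideRing p := by
  obtain ⟨m, hm, z, x, hz, rfl⟩ := LocalBurnsideRing.exists_eq_inv_tmul p X
  have hz0 : (z : ℚ) ≠ 0 := by
    rw [hz]
    refine inv_ne_zero (Nat.cast_ne_zero.2 ?_)
    rintro rfl
    exact hm (dvd_zero p)
  have hx : x ∈ F.burnsideRing := by
    intro P φ hφ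
    refine BurnsideRing.eq_of_mark_eq fun Q => ?_
    have := h _ _ (F.conj_map ⟨φ, hφ, rfl⟩ Q)
    rw [LocalBurnsideRing.mark_tmul, LocalBurnsideRing.mark_tmul, mul_right_inj' hz0] at this
    rw [BurnsideRing.mark_res, BurnsideRing.mark_res]
    exact_mod_cast this
  exact ⟨z ⊗ₜ ⟨x, hx⟩, rfl⟩

/-! ### Congruences between marks -/

/-- If the marks of `X` are stable on subgroups larger than `P`, the marks at conjugates of a fully
normalized `P` are congruent. -/
theorem exists_mark_sub_mark_eq (hS : IsPGroup p S) (hF : F.IsSaturated p) {P Q : Subgroup S}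
    (hP : F.FullyNormalized P) (hQP : F.Conj Q P) {X : LocalBurnsideRing p S}
    (hX : ∀ R R' : Subgroup S, Nat.card P < Nat.card R → F.Conj R R' →
      (LocalBurnsideRing.mark p R' X : ℚ) = LocalBurnsideRing.mark p R X) :
    ∃ z : ZLocal p, (LocalBurnsideRing.mark p P X : ℚ) - LocalBurnsideRing.mark p Q X =
      z * BurnsideRing.mark Q (BurnsideRing.coset Q) := by
  have hmor := F.exists_mor_normalizer hS hF hP hQP
  obtain ⟨m, hm, z, x, hz, rfl⟩ := LocalBurnsideRing.exists_eq_inv_tmul p X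
  have hz0 : (z : ℚ) ≠ 0 := by
    rw [hz]
    refine inv_ne_zero (Nat.cast_ne_zero.2 ?_)
    rintro rfl
    exact hm (dvd_zero p)
  set N : Subgroup S := Subgroup.normalizer (Q : Set S) with hN
  obtain ⟨f, hf, hfP⟩ := hmor
  have hQN : Q ≤ N := Subgroup.le_normalizer
  have hmapQ : (Q.subgroupOf N).map N.subtype = Q := Subgroup.map_subgroupOf_eq_of_le hQN
  have hmark : ∀ R : Subgroup N,
      BurnsideRing.mark R (BurnsideRing.res f x - BurnsideRing.res N.subtype x) =
        BurnsideRing.mark (R.map f) x - BurnsideRing.mark (R.map N.subtype) x := fun R => by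
    rw [map_sub, BurnsideRing.mark_res, BurnsideRing.mark_res]
  -- The difference of the two restrictions to `N` has mark `Φ_P - Φ_Q` at `Q` and, by the assumed
  -- stability, mark zero at larger subgroups of `N`; so this value is itself a Möbius transform.
  obtain ⟨n, hn⟩ := BurnsideRing.exists_moebiusTransform_mark_eq (Q.subgroupOf N)
    (BurnsideRing.res f x - BurnsideRing.res N.subtype x)
  rw [moebiusTransform_eq_self_of_forall_lt, hmark, hfP, hmapQ] at hn
  · refine ⟨z * n, ?_⟩
    have hself : (BurnsideRing.mark (Q.subgroupOf N) (BurnsideRing.coset (Q.subgroupOf N)) : ℚ) =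
        BurnsideRing.mark Q (BurnsideRing.coset Q) := by
      rw [BurnsideRing.mark_coset, BurnsideRing.mark_coset, Int.cast_natCast, Int.cast_natCast,
        fixedCard_coset_self_cast, fixedCard_coset_self_cast,
        Nat.card_congr (Subgroup.subgroupOfEquivOfLe hQN).toEquiv]
      have : (Q.subgroupOf N).Normal := Subgroup.normal_in_normalizer
      rw [Subgroup.normalizer_eq_top (Q.subgroupOf N), Subgroup.card_top]
    rw [LocalBurnsideRing.mark_tmul, LocalBurnsideRing.mark_tmul, ← mul_sub, ← Int.cast_sub, hn,
      hself]
    push_cast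
    ring
  · intro R hR
    rw [hmark]
    have hcard : Nat.card P < Nat.card (R.map N.subtype) := by
      rw [← hQP.card_eq, Subgroup.card_map_of_injective N.subtype_injective,
        ← Nat.card_congr (Subgroup.subgroupOfEquivOfLe hQN).toEquiv]
      exact Set.ncard_lt_ncard hR
    have := hX _ _ hcard (F.conj_map hf R)
    rw [LocalBurnsideRing.mark_tmul, LocalBurnsideRing.mark_tmul, mul_right_inj' hz0] at this
    rw [Int.cast_sub, this, sub_self]

theorem mark_self_eq_div (R : Subgroup S) :
    (BurnsideRing.mark R (BurnsideRing.coset R) : ℚ) =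
      Nat.card (Subgroup.normalizer (R : Set S)) / Nat.card R := by
  rw [BurnsideRing.mark_coset, Int.cast_natCast, fixedCard_coset_self_cast]

/-- If the marks of `X` are stable on subgroups larger than `Q`, the mark at `Q` is congruent to
the average over the conjugates of `Q`. -/
theorem exists_average_sub_mark_eq (hS : IsPGroup p S) (hF : F.IsSaturated p) (Q : Subgroup S)
    {X : LocalBurnsideRing p S}
    (hX : ∀ R R' : Subgroup S, Nat.card Q < Nat.card R → F.Conj R R' →
      (LocalBurnsideRing.mark p R' X : ℚ) = LocalBurnsideRing.mark p R X) :
    ∃ z : ZLocal p, F.average Q (fun R => (LocalBurnsideRing.mark p R X : ℚ)) -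
      LocalBurnsideRing.mark p Q X = z * BurnsideRing.mark Q (BurnsideRing.coset Q) := by
  classical
  have := Fintype.ofFinite (Subgroup S)
  have := Fintype.ofFinite (Quotient (subgroupConjSetoid S))
  obtain ⟨P, hQP, hP⟩ := F.exists_fullyNormalized Q
  have hX' : ∀ R R' : Subgroup S, Nat.card P < Nat.card R → F.Conj R R' →
      (LocalBurnsideRing.mark p R' X : ℚ) = LocalBurnsideRing.mark p R X := by
    rwa [← hQP.card_eq]
  have hS0 : (Nat.card S : ℚ) ≠ 0 := by exact_mod_cast Nat.card_pos.ne'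
  have hP0 : (Nat.card P : ℚ) ≠ 0 := by exact_mod_cast Nat.card_pos.ne'
  have hN0 : ∀ R : Subgroup S, (Nat.card (Subgroup.normalizer (R : Set S)) : ℚ) ≠ 0 := fun R => by
    exact_mod_cast Nat.card_pos.ne'
  -- Deviations are measured from the fully normalized `P`, where the congruence is available, and
  -- not from `Q`.
  let g : Subgroup S → ℚ := fun R => if F.Conj P R then
    (LocalBurnsideRing.mark p P X : ℚ) - LocalBurnsideRing.mark p R X else 0
  have hg : ∀ R s, g (R.map (MulAut.conj s).toMonoidHom) = g R := by
    intro R s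
    have hiff : F.Conj P (R.map (MulAut.conj s).toMonoidHom) ↔ F.Conj P R :=
      ⟨fun h => h.trans (F.conj_map_conj R s).symm, fun h => h.trans (F.conj_map_conj R s)⟩
    simp only [g, hiff, LocalBurnsideRing.mark_map_conj]
  have hgz : ∀ R, ∃ z : ZLocal p,
      g R = z * (Nat.card (Subgroup.normalizer (R : Set S)) / Nat.card P : ℚ) := by
    intro R
    by_cases h : F.Conj P R
    · obtain ⟨z, hz⟩ := F.exists_mark_sub_mark_eq hS hF hP h.symm hX'
      exact ⟨z, by rw [h.card_eq, ← mark_self_eq_div, ← hz]; exact if_pos h⟩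
    · exact ⟨0, by simp [g, h]⟩
  choose z hz using hgz
  have hsum := sum_subgroup_eq_sum_class g hg
  have hsum' : ∑ R, g R = (Nat.card S / Nat.card P : ℚ) *
      (∑ r : Quotient (subgroupConjSetoid S), z r.out : ZLocal p) := by
    rw [hsum, AddSubmonoidClass.coe_finsetSum, Finset.mul_sum]
    refine Finset.sum_congr rfl fun r _ => ?_
    rw [hz]
    have := hN0 r.out
    field_simp
  have havg : (LocalBurnsideRing.mark p P X : ℚ) -
      F.average P (fun R => (LocalBurnsideRing.mark p R X : ℚ)) =
      1 / (Nat.card {R : Subgroup S // F.Conj P R} : ℚ) * ∑ R, g R := by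
    have h1 := F.average_eq_self (Q := P)
      (f := fun _ => (LocalBurnsideRing.mark p P X : ℚ)) fun _ _ => rfl
    rw [← F.average_eq_sum P fun R => (LocalBurnsideRing.mark p P X : ℚ) -
      LocalBurnsideRing.mark p R X]
    conv_lhs => rw [← h1]
    rw [← map_sub]
    rfl
  obtain ⟨k, hk⟩ := IsPGroup.iff_card.1 hS
  -- The ratio of `|S|` to `|N_S P|` times the class size is `p`-local. The factor `d` below trades
  -- `|N_S P|` for `|N_S Q|`.
  have hloc := ZLocal.div_mem_of_not_dvd hk (F.not_dvd_card_conj hS hF P)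
  obtain ⟨a, ha⟩ := IsPGroup.iff_card.1 (hS.to_subgroup (Subgroup.normalizer (Q : Set S)))
  obtain ⟨b, hb⟩ := IsPGroup.iff_card.1 (hS.to_subgroup (Subgroup.normalizer (P : Set S)))
  obtain ⟨d, hd⟩ : Nat.card (Subgroup.normalizer (Q : Set S)) ∣
      Nat.card (Subgroup.normalizer (P : Set S)) := by
    have hab := hP Q hQP.symm
    rw [ha, hb] at hab ⊢
    exact pow_dvd_pow p ((Nat.pow_le_pow_iff_right hp.out.one_lt).1 hab)
  obtain ⟨w, hw⟩ := F.exists_mark_sub_mark_eq hS hF hP hQP hX'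
  refine ⟨w - d * ⟨_, hloc⟩ * ∑ r : Quotient (subgroupConjSetoid S), z r.out, ?_⟩
  have key : F.average Q (fun R => (LocalBurnsideRing.mark p R X : ℚ)) -
      LocalBurnsideRing.mark p Q X = w * BurnsideRing.mark Q (BurnsideRing.coset Q) -
        1 / (Nat.card {R : Subgroup S // F.Conj P R} : ℚ) * ∑ R, g R := by
    rw [← hw, ← havg, F.average_congr hQP]
    ring
  have hC0 := F.card_conj_ne_zero P
  have hNP := hN0 P
  rw [key, hsum', mark_self_eq_div, hQP.card_eq]
  generalize (∑ r : Quotient (subgroupConjSetoid S), z r.out : ZLocal p) = v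
  push_cast
  rw [hd] at hNP ⊢
  push_cast at hNP ⊢
  have hd0 := right_ne_zero_of_mul hNP
  have hNQ := left_ne_zero_of_mul hNP
  field_simp

/-! ### Construction of the stabilization -/

/-- Making the marks stable on the subgroups of order `n`, without changing averages. -/
theorem exists_stable_of_stable_above (hS : IsPGroup p S) (hF : F.IsSaturated p) (n : ℕ)
    (X : LocalBurnsideRing p S)
    (hX : ∀ R R' : Subgroup S, n < Nat.card R → F.Conj R R' →
      (LocalBurnsideRing.mark p R' X : ℚ) = LocalBurnsideRing.mark p R X) :
    ∃ Y : LocalBurnsideRing p S,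
      (∀ Q, F.average Q (fun R => (LocalBurnsideRing.mark p R Y : ℚ)) =
        F.average Q (fun R => (LocalBurnsideRing.mark p R X : ℚ))) ∧
      ∀ R R' : Subgroup S, n ≤ Nat.card R → F.Conj R R' →
        (LocalBurnsideRing.mark p R' Y : ℚ) = LocalBurnsideRing.mark p R Y := by
  classical
  have := Fintype.ofFinite (Subgroup S)
  have := Fintype.ofFinite (Quotient (subgroupConjSetoid S))
  -- The coefficient that moves the mark at a subgroup of order `n` to its average; other orders get
  -- zero.
  have hc : ∀ r : Quotient (subgroupConjSetoid S), ∃ z : ZLocal p,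
      (if Nat.card r.out = n then
        F.average r.out (fun R => (LocalBurnsideRing.mark p R X : ℚ)) -
          LocalBurnsideRing.mark p r.out X else 0) =
        z * BurnsideRing.mark r.out (BurnsideRing.coset r.out) := by
    intro r
    split_ifs with h
    · exact F.exists_average_sub_mark_eq hS hF r.out (h ▸ hX)
    · exact ⟨0, by simp⟩
  choose c hc using hc
  have hmark : ∀ Q, (LocalBurnsideRing.mark p Q
      (X + ∑ r, c r • LocalBurnsideRing.coset p r.out) : ℚ) =
      LocalBurnsideRing.mark p Q X +
        ∑ r, (c r : ℚ) * (BurnsideRing.mark Q (BurnsideRing.coset r.out) : ℚ) := by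
    intro Q
    rw [map_add, Subring.coe_add, LocalBurnsideRing.mark_eq_sum p
      (finsum_eq_sum_of_fintype _).symm Q, finsum_eq_sum_of_fintype]
  have hc0 : ∀ r : Quotient (subgroupConjSetoid S), Nat.card r.out ≠ n → c r = 0 := by
    intro r hr
    have := hc r
    rw [if_neg hr] at this
    have h0 := (mul_eq_zero.1 this.symm).resolve_right (BurnsideRing.mark_self_ne_zero _)
    exact_mod_cast h0
  refine ⟨X + ∑ r, c r • LocalBurnsideRing.coset p r.out, fun Q => ?_, ?_⟩
  · have hfun : (fun R => (LocalBurnsideRing.mark p R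
        (X + ∑ r, c r • LocalBurnsideRing.coset p r.out) : ℚ)) =
        (fun R => (LocalBurnsideRing.mark p R X : ℚ)) +
          ∑ r, (c r : ℚ) • fun R => (BurnsideRing.mark R (BurnsideRing.coset r.out) : ℚ) := by
      ext R
      rw [hmark]
      simp
    rw [hfun, map_add, map_sum, add_eq_left]
    let a : Subgroup S → ℚ := fun P =>
      F.average Q fun R => (BurnsideRing.mark R (BurnsideRing.coset P) : ℚ)
    have ha : ∀ P P', F.Conj P P' → a P = a P' := fun P P' h => F.average_mark_coset_congr Q h
    let h : Subgroup S → ℚ := fun R => if Nat.card R = n then a R else 0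
    have hh : ∀ P P', F.Conj P P' → h P = h P' := fun P P' hPP => by
      simp only [h, hPP.card_eq, ha P P' hPP]
    have hz := F.sum_average_sub_mul (fun R => (LocalBurnsideRing.mark p R X : ℚ)) h hh
    rw [sum_subgroup_eq_sum_class] at hz
    · have hS0 : (Nat.card S : ℚ) ≠ 0 := by exact_mod_cast Nat.card_pos.ne'
      -- Since `Φ_R(S/R) = |N_S R|/n`, each coefficient is the deviation times `n/|S|` times the
      -- size of the `S`-class of `R`. The change in the average is thus a sum over all subgroups,
      -- and it vanishes.
      rw [← mul_zero (n / Nat.card S : ℚ), ← hz, Finset.mul_sum]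
      refine Finset.sum_congr rfl fun r _ => ?_
      have hN0 : (Nat.card (Subgroup.normalizer (r.out : Set S)) : ℚ) ≠ 0 := by
        exact_mod_cast Nat.card_pos.ne'
      rw [map_smul, smul_eq_mul]
      change (c r : ℚ) * a r.out = _
      by_cases hrn : Nat.card r.out = n
      · have hcr := hc r
        have hn0 : (n : ℚ) ≠ 0 := by
          rw [← hrn]
          exact_mod_cast Nat.card_pos.ne'
        rw [if_pos hrn, mark_self_eq_div, hrn] at hcr
        rw [hcr, show h r.out = a r.out from if_pos hrn]
        field_simp
      · rw [hc0 r hrn, show h r.out = 0 from if_neg hrn]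
        simp
    · intro R s
      have hR := F.conj_map_conj R s
      rw [← F.average_congr hR, ← hh _ _ hR, LocalBurnsideRing.mark_map_conj]
  · have hstab : ∀ Q : Subgroup S, n ≤ Nat.card Q → (LocalBurnsideRing.mark p Q
        (X + ∑ r, c r • LocalBurnsideRing.coset p r.out) : ℚ) =
        F.average Q (fun R => (LocalBurnsideRing.mark p R X : ℚ)) := by
      intro Q hQ
      -- For `|Q| ≥ n = |R|`, a `Q`-fixed point on `S/R` forces `Q` to be `S`-conjugate to `R`, so
      -- only the class of `Q` contributes.
      rw [hmark, Finset.sum_eq_single (Quotient.mk _ Q)]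
      · set r : Quotient (subgroupConjSetoid S) := Quotient.mk _ Q with hr
        obtain ⟨s, hs⟩ : (subgroupConjSetoid S).r Q r.out :=
          (subgroupConjSetoid S).symm (Quotient.mk_out (s := subgroupConjSetoid S) Q)
        have hcr := hc r
        have hQr := F.conj_map_conj Q s
        rw [hs] at hQr
        rw [← hQr.card_eq, ← F.average_congr hQr] at hcr
        rw [← BurnsideRing.mark_map_conj Q s, hs, ← hcr, ← LocalBurnsideRing.mark_map_conj p Q s, hs]
        split_ifs with hn
        · ring
        · rw [add_zero, ← hs, LocalBurnsideRing.mark_map_conj, F.average_eq_self]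
          intro Q' hQ'
          exact hX Q Q' (lt_of_le_of_ne hQ (Ne.symm hn)) hQ'
      · intro r _ hr
        by_cases hrn : Nat.card r.out = n
        · rw [mul_eq_zero]
          right
          by_contra hne
          rw [BurnsideRing.mark_coset] at hne
          obtain ⟨s, hs⟩ := fixedCard_coset_ne_zero (Q := Q) (P := r.out)
            fun h => hne (by rw [h]; simp)
          refine hr ?_
          rw [← Quotient.out_eq r]
          refine (Quotient.sound (s := subgroupConjSetoid S) ⟨s, ?_⟩).symm
          refine Subgroup.eq_of_le_of_card_ge hs ?_
          rw [card_map_conj, hrn]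
          exact hQ
        · rw [hc0 r hrn]
          simp
      · simp
    intro R R' hR hRR
    rw [hstab R hR, hstab R' (hRR.card_eq ▸ hR), F.average_congr hRR]

theorem exists_mark_eq_average (hS : IsPGroup p S) (hF : F.IsSaturated p)
    (X : LocalBurnsideRing p S) :
    ∃ Y : LocalBurnsideRing p S, ∀ Q, (LocalBurnsideRing.mark p Q Y : ℚ) =
      F.average Q (fun R => (LocalBurnsideRing.mark p R X : ℚ)) := by
  -- Stage `k` is stable on orders above `|S| - k`. Stage `0` is vacuous and stage `|S|` covers
  -- every subgroup, where stable marks coincide with their averages.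
  have key : ∀ k : ℕ, ∃ Y : LocalBurnsideRing p S,
      (∀ Q, F.average Q (fun R => (LocalBurnsideRing.mark p R Y : ℚ)) =
        F.average Q (fun R => (LocalBurnsideRing.mark p R X : ℚ))) ∧
      ∀ R R' : Subgroup S, Nat.card S < Nat.card R + k → F.Conj R R' →
        (LocalBurnsideRing.mark p R' Y : ℚ) = LocalBurnsideRing.mark p R Y := by
    intro k
    induction k with
    | zero =>
      refine ⟨X, fun _ => rfl, fun R R' hR _ => ?_⟩
      have := Subgroup.card_le_card_group R
      omega
    | succ k ih =>
      obtain ⟨Y, hY, hYs⟩ := ih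
      obtain ⟨Z, hZ, hZs⟩ := F.exists_stable_of_stable_above hS hF (Nat.card S - k) Y
        fun R R' hR => hYs R R' (by omega)
      exact ⟨Z, fun Q => (hZ Q).trans (hY Q), fun R R' hR => hZs R R' (by omega)⟩
  obtain ⟨Y, hY, hYs⟩ := key (Nat.card S)
  refine ⟨Y, fun Q => ?_⟩
  rw [← hY, F.average_eq_self]
  intro Q' hQ
  refine hYs Q Q' ?_ hQ
  have : 0 < Nat.card Q := Nat.card_pos
  omega

end FusionSystem

/-! ### The map `π`, and the basis formed by the `β_P`. -/

namespace FusionSystem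

variable {S : Type u} [Group S] (F : FusionSystem S) {p : ℕ} [hp : Fact p.Prime]

theorem subConj_of_card_hom_ne_zero {F : FusionSystem S} {Q R P : Subgroup S} (hRQ : R ≤ Q)
    (h : Nat.card (F.Hom Q P) ≠ 0) : F.SubConj R P := by
  obtain ⟨⟨φ, hφ⟩⟩ := (Nat.card_ne_zero.1 h).1
  have hf := F.mor_restrict (F.subtype_comp_mem_mor hφ) hRQ
  refine ⟨_, ?_, F.conj_range hf⟩
  rintro _ ⟨x, rfl⟩
  exact (φ _).2

variable [Finite S]

theorem card_hom_ne_zero (P Q : Subgroup S) (h : P ≤ Q) : (Nat.card (F.Hom P Q) : ℚ) ≠ 0 := by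
  have : Nonempty (F.Hom P Q) := ⟨⟨_, F.inclusion_mem h⟩⟩
  have : Finite (P →* Q) := DFunLike.finite _
  exact_mod_cast Nat.card_pos.ne'

/-- The chosen elements depend linearly on `X` because averaging is linear and marks are jointly
injective. -/
theorem exists_isStabilization (hS : IsPGroup p S) (hF : F.IsSaturated p) :
    ∃ π : LocalBurnsideRing p S →ₗ[ZLocal p] F.localBurnsideRing p, F.IsStabilization p π := by
  choose Y hY using F.exists_mark_eq_average hS hF
  have hmem : ∀ X, Y X ∈ F.localBurnsideRing p := fun X =>
    F.mem_localBurnsideRing_of_mark_eq fun Q Q' h => by rw [hY, hY, F.average_congr h]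
  refine ⟨
    { toFun := fun X => ⟨Y X, hmem X⟩
      map_add' := fun X X' => Subtype.ext ?_
      map_smul' := fun z X => Subtype.ext ?_ }, fun X Z => ⟨?_, fun h => ?_⟩⟩
  · refine LocalBurnsideRing.eq_of_mark_eq p fun Q => ?_
    change (LocalBurnsideRing.mark p Q (Y (X + X')) : ℚ) =
      LocalBurnsideRing.mark p Q (Y X + Y X')
    rw [map_add, Subring.coe_add, hY, hY, hY, ← map_add]
    congr 1
    ext R
    simp
  · refine LocalBurnsideRing.eq_of_mark_eq p fun Q => ?_
    change (LocalBurnsideRing.mark p Q (Y (z • X)) : ℚ) = LocalBurnsideRing.mark p Q (z • Y X)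
    rw [LocalBurnsideRing.mark_smul, hY, hY, ← smul_eq_mul, ← map_smul]
    congr 1
    ext R
    rw [LocalBurnsideRing.mark_smul]
    rfl
  · rintro rfl Q
    exact hY X Q
  · exact LocalBurnsideRing.eq_of_mark_eq p fun Q => (hY X Q).trans (h Q).symm

variable {F} {π : LocalBurnsideRing p S →ₗ[ZLocal p] F.localBurnsideRing p}

theorem IsStabilization.mark_eq (h : F.IsStabilization p π) (X : LocalBurnsideRing p S)
    (Q : Subgroup S) : (LocalBurnsideRing.mark p Q (π X) : ℚ) =
      F.average Q fun R => (LocalBurnsideRing.mark p R X : ℚ) :=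
  (h X _).1 rfl Q

/-- Stable marks equal their averages, so `π` is a projection. Its surjectivity yields the spanning
property. -/
theorem IsStabilization.apply_coe (h : F.IsStabilization p π) (X : F.localBurnsideRing p) :
    π X = X :=
  Subtype.ext <| LocalBurnsideRing.eq_of_mark_eq p fun Q => by
    rw [h.mark_eq, F.average_eq_self]
    exact fun Q' hQ => F.mark_eq_of_mem_localBurnsideRing X.2 hQ

theorem IsStabilization.mark_coset (h : F.IsStabilization p π) (P Q : Subgroup S) :
    (LocalBurnsideRing.mark p Q (π (LocalBurnsideRing.coset p P)) : ℚ) =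
      (Nat.card (F.Hom Q P) * Nat.card S : ℚ) / (Nat.card P * Nat.card (F.Hom Q ⊤)) := by
  rw [h.mark_eq, ← average_mark_coset]
  simp only [LocalBurnsideRing.mark_coset]

theorem IsStabilization.coset_congr (h : F.IsStabilization p π) {P P' : Subgroup S}
    (hP : F.Conj P P') :
    π (LocalBurnsideRing.coset p P) = π (LocalBurnsideRing.coset p P') :=
  Subtype.ext <| LocalBurnsideRing.eq_of_mark_eq p fun Q => by
    rw [h.mark_coset, h.mark_coset, F.card_hom_congr Q hP, hP.card_eq]

/-- The table of marks is triangular: `Φ_Q(β_P)` vanishes unless `Q` is subconjugate to `P`, and is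
nonzero at `Q = P`. Two equal combinations are compared at a class of largest order among those
where the coefficients differ. -/
theorem IsStabilization.linearIndependent (h : F.IsStabilization p π) :
    LinearIndependent (ZLocal p)
      fun c : F.ConjClass => π (LocalBurnsideRing.coset p c.out) := by
  have := Fintype.ofFinite F.ConjClass
  refine Fintype.linearIndependent_iffₛ.2 fun f g hfg => ?_
  have hmark : ∀ Q : Subgroup S, ∑ c : F.ConjClass, ((f c : ℚ) - g c) *
      ((Nat.card (F.Hom Q c.out) * Nat.card S : ℚ) /
        (Nat.card c.out * Nat.card (F.Hom Q ⊤))) = 0 := by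
    intro Q
    have hcoe : ∀ g : F.ConjClass → ZLocal p,
        (LocalBurnsideRing.mark p Q (∑ c, g c • π (LocalBurnsideRing.coset p c.out) :
          F.localBurnsideRing p) : ℚ) = ∑ c : F.ConjClass, (g c : ℚ) *
            ((Nat.card (F.Hom Q c.out) * Nat.card S : ℚ) /
              (Nat.card c.out * Nat.card (F.Hom Q ⊤))) := by
      intro g
      simp only [AddSubmonoidClass.coe_finsetSum, map_sum, Subalgebra.coe_smul,
        LocalBurnsideRing.mark_smul, h.mark_coset]
    simp only [sub_mul, Finset.sum_sub_distrib]
    rw [← hcoe, ← hcoe, hfg, sub_self]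
  by_contra! hne
  obtain ⟨c₀, hc₀⟩ := hne
  have : Nonempty {c : F.ConjClass // f c ≠ g c} := ⟨⟨c₀, hc₀⟩⟩
  obtain ⟨⟨c, hc⟩, hmax⟩ := Finite.exists_max fun c : {c : F.ConjClass // f c ≠ g c} =>
    Nat.card c.1.out
  have hmarkc := hmark c.out
  rw [Finset.sum_eq_single c] at hmarkc
  · have h1 := F.card_hom_ne_zero c.out c.out le_rfl
    have h2 := F.card_hom_ne_zero c.out ⊤ le_top
    have h3 : (Nat.card S : ℚ) ≠ 0 := by exact_mod_cast Nat.card_pos.ne'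
    have h4 : (Nat.card c.out : ℚ) ≠ 0 := by exact_mod_cast Nat.card_pos.ne'
    have h5 : (f c : ℚ) - g c ≠ 0 := fun h => hc (Subtype.ext (sub_eq_zero.1 h))
    exact mul_ne_zero h5 (div_ne_zero (mul_ne_zero h1 h3) (mul_ne_zero h4 h2)) hmarkc
  · intro d _ hd
    by_cases hgd : f d = g d
    · simp [hgd]
    by_cases hcard : Nat.card (F.Hom c.out d.out) = 0
    · simp [hcard]
    obtain ⟨Q, hQ, hconj⟩ := subConj_of_card_hom_ne_zero (F := F) le_rfl hcard
    have hQd : Q = d.out := Subgroup.eq_of_le_of_card_ge hQ (by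
      rw [← hconj.card_eq]
      exact hmax ⟨d, hgd⟩)
    subst hQd
    refine absurd ?_ hd
    rw [← Quotient.out_eq c, ← Quotient.out_eq d]
    exact Quotient.sound hconj.symm
  · simp

theorem IsStabilization.span_eq_top (h : F.IsStabilization p π) :
    ⊤ ≤ Submodule.span (ZLocal p)
      (Set.range fun c : F.ConjClass => π (LocalBurnsideRing.coset p c.out)) := by
  have := Fintype.ofFinite (Quotient (subgroupConjSetoid S))
  rintro X -
  obtain ⟨c, hc⟩ := LocalBurnsideRing.exists_eq_sum_coset p (X : LocalBurnsideRing p S)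
  rw [← h.apply_coe X, hc, finsum_eq_sum_of_fintype, map_sum]
  refine Submodule.sum_mem _ fun r _ => ?_
  rw [map_smul]
  refine Submodule.smul_mem _ _ (Submodule.subset_span ⟨Quotient.mk _ r.out, ?_⟩)
  exact h.coset_congr (Quotient.mk_out (s := F.conjSetoid) r.out)

end FusionSystem

theorem mainTheorem11 (p : ℕ) [Fact p.Prime] (S : Type u) [Group S] [Finite S]
    (hS : IsPGroup p S) (F : FusionSystem S) (hF : F.IsSaturated p) :
    ∃ π : LocalBurnsideRing p S →ₗ[ZLocal p] F.localBurnsideRing p,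
      F.IsStabilization p π ∧
      -- the elements `β_P = π [S/P]`, one for each `F`-conjugacy class, form a basis
      (∃ b : Module.Basis F.ConjClass (ZLocal p) (F.localBurnsideRing p),
        ∀ P : Subgroup S, b (Quotient.mk _ P) = π (LocalBurnsideRing.coset p P)) ∧
      -- their marks
      (∀ P Q : Subgroup S,
        (LocalBurnsideRing.mark p Q (π (LocalBurnsideRing.coset p P)) : ℚ) =
          (Nat.card (F.Hom Q P) * Nat.card S : ℚ) / (Nat.card P * Nat.card (F.Hom Q ⊤))) ∧
      -- their expansion in transitive `S`-sets
      (∀ P : Subgroup S, ∃ c : Quotient (subgroupConjSetoid S) → ZLocal p,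
        (π (LocalBurnsideRing.coset p P) : LocalBurnsideRing p S) =
          ∑ᶠ r : Quotient (subgroupConjSetoid S), c r • LocalBurnsideRing.coset p r.out ∧
        (∀ R : Subgroup S, (c (Quotient.mk _ R) : ℚ) =
          1 / (BurnsideRing.mark R (BurnsideRing.coset R) : ℚ) *
            ∑ᶠ Q : {Q : Subgroup S // R ≤ Q},
              (LocalBurnsideRing.mark p Q.1 (π (LocalBurnsideRing.coset p P)) : ℚ) *
                (subgroupMoebius R Q.1 : ℚ)) ∧
        (∀ R : Subgroup S, (c (Quotient.mk _ R) : ℚ) =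
          (Nat.card R * Nat.card S : ℚ) /
              (Nat.card (Subgroup.normalizer (R : Set S)) * Nat.card P) *
            ∑ᶠ Q : {Q : Subgroup S // R ≤ Q},
              (Nat.card (F.Hom Q.1 P) : ℚ) / Nat.card (F.Hom Q.1 ⊤) *
                (subgroupMoebius R Q.1 : ℚ)) ∧
        (∀ R : Subgroup S, ¬ F.SubConj R P → c (Quotient.mk _ R) = 0)) := by
  obtain ⟨π, hπ⟩ := F.exists_isStabilization hS hF
  refine ⟨π, hπ, ⟨Module.Basis.mk hπ.linearIndependent hπ.span_eq_top, fun P => ?_⟩,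
    hπ.mark_coset, fun P => ?_⟩
  · rw [Module.Basis.mk_apply]
    exact hπ.coset_congr (Quotient.mk_out (s := F.conjSetoid) P)
  · obtain ⟨c, hc⟩ := LocalBurnsideRing.exists_eq_sum_coset p
      (π (LocalBurnsideRing.coset p P) : LocalBurnsideRing p S)
    have hcoeff := LocalBurnsideRing.coeff_eq p hc
    have hform : ∀ R : Subgroup S, (c (Quotient.mk _ R) : ℚ) =
        (Nat.card R * Nat.card S : ℚ) /
            (Nat.card (Subgroup.normalizer (R : Set S)) * Nat.card P) *
          ∑ᶠ Q : {Q : Subgroup S // R ≤ Q},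
            (Nat.card (F.Hom Q.1 P) : ℚ) / Nat.card (F.Hom Q.1 ⊤) *
              (subgroupMoebius R Q.1 : ℚ) := by
      intro R
      rw [hcoeff, FusionSystem.mark_self_eq_div, moebiusTransform_apply, mul_finsum, mul_finsum]
      refine finsum_congr fun Q => ?_
      rw [hπ.mark_coset]
      have h1 : (Nat.card R : ℚ) ≠ 0 := by exact_mod_cast Nat.card_pos.ne'
      have h2 : (Nat.card P : ℚ) ≠ 0 := by exact_mod_cast Nat.card_pos.ne'
      have h3 := F.card_hom_ne_zero Q.1 ⊤ le_top
      have h4 : (Nat.card (Subgroup.normalizer (R : Set S)) : ℚ) ≠ 0 := by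
        exact_mod_cast Nat.card_pos.ne'
      field_simp
    refine ⟨c, hc, hcoeff, hform, fun R hR => ?_⟩
    have h0 := hform R
    rw [finsum_eq_zero_of_forall_eq_zero, mul_zero] at h0
    · exact_mod_cast h0
    · intro Q
      -- A morphism `Q → P` with `R ≤ Q` would restrict to `R` and make it subconjugate to `P`, so
      -- every term vanishes.
      have : Nat.card (F.Hom Q.1 P) = 0 := by
        by_contra hne
        exact hR (FusionSystem.subConj_of_card_hom_ne_zero Q.2 hne)
      rw [this, Nat.cast_zero, zero_div, zero_mul]
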